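/- A promise problem is a pair $(L_1,L_0)$ of disjoint sets of binary words; a reduction of $(L_1,L_0)$ to $(M_1,M_0)$ is a map $f$ with $f(L_1)\subseteq M_1$ and $f(L_0)\subseteq M_0$. Every binary word $x$ is read as a description (transition table) of a DFA over $\{0,1\}$, with language $L(x)$. For a language $L$ (the filter), $\mathrm{reg}(L)=\{x : L(x)\cap L\neq\emptyset\}$. For a family $F$ of languages, the RR (regular realizability) promise problem with filter $L$ and promise $L(x)\in F$ is the pair $(\{x: L(x)\in F,\ x\in\mathrm{reg}(L)\},\{x: L(x)\in F,\ x\notin\mathrm{reg}(L)\})$. FL is the class of functions on binary words computed by deterministic log-space transducers; FNL is the class of those computed by deterministic log-space transducers with an oracle from NL. Two promise problems are equivalent under nondeterministic log-space reductions if each reduces to the other by a map in FNL. **Theorem.** Every promise problem $(L_1,L_0)$ with $L_1\neq\emptyset$ is equivalent, under nondeterministic log-space reductions, to an RR promise problem, namely the one with filter $L_1$ and the promise that the DFA recognizes a one-element language $\{w\}$ with $w\in L_1\cup L_0$. More precisely, there are a map $w\mapsto A_w$ in FL and a map $g$ in FNL, neither of them depending on $(L_1,L_0)$, such that $A_w$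 describes a minimal DFA recognizing $\{w\}$ for each binary word $w$, and $g(x)=w$ whenever $L(x)=\{w\}$. For each promise problem $(L_1,L_0)$ with $L_1\ne\emptyset$, the map $w\mapsto A_w$ reduces $(L_1,L_0)$ to this RR promise problem, and $g$ reduces this RR promise problem to $(L_1,L_0)$. For the RR promise problem $\mathrm{reg}(L_1:|R|=1)$, with filter $L_1$ and the promise $|L(x)|=1$ only, the following hold: $w\mapsto A_w$ still reduces $(L_1,L_0)$ to it; for every $x$ with $|L(x)|=1$ one has $x\in\mathrm{reg}(L_1)$ if and only if $g(x)\in L_1$; and if $L_1\cup L_0$ is the set of all binary words, then $(L_1,L_0)$ and $\mathrm{reg}(L_1:|R|=1)$ are equivalent under nondeterministic log-space reductions. -/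

import Mathlib

namespace RegReal

/-! ## Space-bounded Turing machines -/

/-- Binary words. -/
abbrev Word := List Bool

/-- What the head of the read-only input tape can see: an end marker or an input bit. -/
inductive InSym
  | left
  | bit (b : Bool)
  | right

/-- Contents of the cells `0, …, |x| + 1` of the input tape:
left end marker, the bits of `x`, right end marker. -/
def inputAt (x : Word) (i : ℕ) : InSym :=
  if i = 0 then .left else
    match x[i - 1]? with
    | some b => .bit b
    | none => .right

/-- Head moves. -/
inductive Move
  | left
  | stay
  | right

/-- Tapes have a first cell `0`; moving left from it has no effect. -/
def Move.apply : Move → ℕ → ℕ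
  | .left, i => i - 1
  | .stay, i => i
  | .right, i => i + 1

/-- Control state, input head, and `k` work tapes with their contents and heads. -/
structure Memory (k : ℕ) (Γ σ : Type) where
  state : σ
  inPos : ℕ
  work : Fin k → ℕ → Γ
  pos : Fin k → ℕ

/-- The effect of one move of a machine on its memory. -/
structure Instr (k : ℕ) (Γ σ : Type) where
  next : σ
  inMove : Move
  write : Fin k → Γ
  move : Fin k → Move

/-- Start: the input head is on the left end marker, the work tapes are blank. -/
def Memory.init {k : ℕ} {Γ σ : Type} (start : σ) (blank : Γ) : Memory k Γ σ where
  state := start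
  inPos := 0
  work := fun _ _ => blank
  pos := fun _ => 0

/-- The symbols under the heads of the work tapes. -/
def Memory.scan {k : ℕ} {Γ σ : Type} (m : Memory k Γ σ) : Fin k → Γ :=
  fun j => m.work j (m.pos j)

/-- Execution of an instruction on input `x`. The input head never leaves the cells
`0, …, |x| + 1`. -/
def Memory.exec {k : ℕ} {Γ σ : Type} (x : Word) (m : Memory k Γ σ) (I : Instr k Γ σ) :
    Memory k Γ σ where
  state := I.next
  inPos := min (I.inMove.apply m.inPos) (x.length + 1)
  work := fun j => Function.update (m.work j) (m.pos j) (I.write j)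
  pos := fun j => (I.move j).apply (m.pos j)

/-- All work heads are inside the first `s` cells. -/
def Memory.InSpace {k : ℕ} {Γ σ : Type} (m : Memory k Γ σ) (s : ℕ) : Prop :=
  ∀ j, m.pos j < s

/-- The space bound `O(log n)` with constant `c`, for inputs of length `n`. -/
def logBound (c n : ℕ) : ℕ := c * (Nat.log 2 n + 1)

/-! ### Nondeterministic acceptors and the class NL -/

/-- A nondeterministic Turing machine with a read-only input tape and work tapes. -/
structure NTM where
  k : ℕ
  Γ : Type
  σ : Type
  finΓ : Finite Γ
  finσ : Finite σ
  blank : Γ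
  start : σ
  accept : Set σ
  trans : σ → InSym → (Fin k → Γ) → Set (Instr k Γ σ)

/-- One step on input `x`. -/
def NTM.Step (M : NTM) (x : Word) (m m' : Memory M.k M.Γ M.σ) : Prop :=
  ∃ I ∈ M.trans m.state (inputAt x m.inPos) m.scan, m' = m.exec x I

/-- Memories that occur in some computation on input `x`. -/
def NTM.Reachable (M : NTM) (x : Word) (m : Memory M.k M.Γ M.σ) : Prop :=
  Relation.ReflTransGen (M.Step x) (Memory.init M.start M.blank) m

/-- Some computation on input `x` enters an accepting state. -/
def NTM.Accepts (M : NTM) (x : Word) : Prop :=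
  ∃ m, M.Reachable x m ∧ m.state ∈ M.accept

/-- Every computation on every input uses logarithmic work space. -/
def NTM.LogSpace (M : NTM) : Prop :=
  ∃ c : ℕ, ∀ x m, M.Reachable x m → m.InSpace (logBound c x.length)

/-- The class NL. -/
def NL (L : Set Word) : Prop :=
  ∃ M : NTM, M.LogSpace ∧ ∀ x, M.Accepts x ↔ x ∈ L

/-! ### Deterministic transducers and the function classes FL and FNL -/

/-- What is done in one step with the one-way write-only oracle tape. -/
inductive OracleAct
  | idle
  | write (b : Bool)
  | query

/-- An instruction of a transducer: besides the action on the memory, at most one bit is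
appended to the write-only output tape, and the oracle tape may be used. -/
structure TInstr (k : ℕ) (Γ σ : Type) extends Instr k Γ σ where
  out : Option Bool
  oracle : OracleAct

/-- A deterministic Turing machine with a read-only input tape, work tapes, a write-only output
tape and an oracle tape. The transition also depends on the last answer of the oracle; it is
`none` where the machine halts. -/
structure Transducer where
  k : ℕ
  Γ : Type
  σ : Type
  finΓ : Finite Γ
  finσ : Finite σ
  blank : Γ
  start : σ
  trans : σ → InSym → (Fin k → Γ) → Bool → Option (TInstr k Γ σ)

/-- A configuration: memory, output, current query, last answer of the oracle. -/
structure Transducer.Config (M : Transducer) where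
  mem : Memory M.k M.Γ M.σ
  out : Word
  query : Word
  answer : Bool

/-- The start configuration. -/
def Transducer.init (M : Transducer) : M.Config :=
  ⟨Memory.init M.start M.blank, [], [], false⟩

open Classical in
/-- Execution of an instruction with oracle set `O`. A query is overwritten by its answer, which
is one bit; then the machine can write the next query. -/
noncomputable def Transducer.exec (M : Transducer) (O : Set Word) (x : Word) (C : M.Config)
    (I : TInstr M.k M.Γ M.σ) : M.Config where
  mem := C.mem.exec x I.toInstr
  out := C.out ++ I.out.toList
  query :=
    match I.oracle with
    | .idle => C.query
    | .write b => C.query ++ [b]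
    | .query => []
  answer :=
    match I.oracle with
    | .query => decide (C.query ∈ O)
    | _ => C.answer

/-- The instruction that is executed next on input `x`, if any. -/
def Transducer.current (M : Transducer) (x : Word) (C : M.Config) : Option (TInstr M.k M.Γ M.σ) :=
  M.trans C.mem.state (inputAt x C.mem.inPos) C.mem.scan C.answer

/-- One step on input `x` with oracle `O`. -/
def Transducer.Step (M : Transducer) (O : Set Word) (x : Word) (C C' : M.Config) : Prop :=
  ∃ I, M.current x C = some I ∧ C' = M.exec O x C I

/-- Configurations that occur in the computation on input `x` with oracle `O`. -/
def Transducer.Reachable (M : Transducer) (O : Set Word) (x : Word) (C : M.Config) : Prop :=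
  Relation.ReflTransGen (M.Step O x) M.init C

/-- With oracle `O`, the machine uses logarithmic work space on every input, and on every input
`x` it halts with output `f x`. -/
def Transducer.LogSpaceComputes (M : Transducer) (O : Set Word) (f : Word → Word) : Prop :=
  (∃ c : ℕ, ∀ x C, M.Reachable O x C → C.mem.InSpace (logBound c x.length)) ∧
  ∀ x, ∃ C, M.Reachable O x C ∧ M.current x C = none ∧ C.out = f x

/-- The machine never touches its oracle tape. -/
def Transducer.OracleFree (M : Transducer) : Prop :=
  ∀ q s t a I, M.trans q s t a = some I → I.oracle = .idle

/-- Functions computed in deterministic logarithmic space. -/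
def FL (f : Word → Word) : Prop :=
  ∃ M : Transducer, M.OracleFree ∧ M.LogSpaceComputes ∅ f

/-- The class FNL: functions computed by deterministic logarithmic space machines that use an
oracle from NL. -/
def FNL (f : Word → Word) : Prop :=
  ∃ (M : Transducer) (O : Set Word), NL O ∧ M.LogSpaceComputes O f

/-! ## Promise problems and reductions -/

/-- A promise problem: decide whether `w ∈ yes`, given that `w ∈ yes` or `w ∈ no`. -/
structure PromiseProblem where
  yes : Set Word
  no : Set Word
  disj : Disjoint yes no

/-- `f` is a many-one reduction of the promise problem `P` to the promise problem `Q`. -/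
def ReducesVia (f : Word → Word) (P Q : PromiseProblem) : Prop :=
  (∀ x ∈ P.yes, f x ∈ Q.yes) ∧ ∀ x ∈ P.no, f x ∈ Q.no

/-- Many-one reducibility by functions in FNL (nondeterministic log space reductions). -/
def NLReduces (P Q : PromiseProblem) : Prop :=
  ∃ f, FNL f ∧ ReducesVia f P Q

/-- Equivalence under nondeterministic log space reductions. -/
def NLEquiv (P Q : PromiseProblem) : Prop :=
  NLReduces P Q ∧ NLReduces Q P

/-! ## Descriptions of finite automata -/

/-- The transition table of a complete DFA over the binary alphabet with states `0, …, n` and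
initial state `0`. -/
structure Table where
  n : ℕ
  acc : Fin (n + 1) → Bool
  next : Fin (n + 1) → Bool → Fin (n + 1)

/-- The automaton given by a transition table. -/
def Table.toDFA (T : Table) : DFA Bool (Fin (T.n + 1)) where
  step := T.next
  start := 0
  accept := {q | T.acc q = true}

/-- A row `(a, s, t)` of a transition table is written as `a 1ˢ 0 1ᵗ 0`. -/
def encodeRow (r : Bool × ℕ × ℕ) : Word :=
  r.1 :: (List.replicate r.2.1 true ++ false :: (List.replicate r.2.2 true ++ [false]))

/-- The row of state `q`: whether `q` is accepting, and its successors on `0` and on `1`. -/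
def Table.row (T : Table) (q : Fin (T.n + 1)) : Bool × ℕ × ℕ :=
  (T.acc q, (T.next q false : ℕ), (T.next q true : ℕ))

/-- The binary word describing a transition table: its rows, one after another. -/
def Table.encode (T : Table) : Word :=
  (List.ofFn T.row).flatMap encodeRow

theorem unary_inj : ∀ (s t : ℕ) (u v : Word),
    List.replicate s true ++ false :: u = List.replicate t true ++ false :: v → s = t ∧ u = v
  | 0, 0, u, v, h => by simpa using h
  | 0, t + 1, u, v, h => by simp [List.replicate_succ] at h
  | s + 1, 0, u, v, h => by simp [List.replicate_succ] at h
  | s + 1, t + 1, u, v, h => by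
      have h' : List.replicate s true ++ false :: u = List.replicate t true ++ false :: v := by
        simpa [List.replicate_succ] using h
      obtain ⟨h1, h2⟩ := unary_inj s t u v h'
      exact ⟨by rw [h1], h2⟩

theorem encodeRows_inj : ∀ (l m : List (Bool × ℕ × ℕ)),
    l.flatMap encodeRow = m.flatMap encodeRow → l = m
  | [], [], _ => rfl
  | [], r :: m, h => by simp [encodeRow] at h
  | r :: l, [], h => by simp [encodeRow] at h
  | (a, s, t) :: l, (b, u, v) :: m, h => by
      simp only [List.flatMap_cons, encodeRow, List.cons_append, List.append_assoc,
        List.cons.injEq, List.nil_append] at h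
      obtain ⟨h0, h⟩ := h
      obtain ⟨h1, h⟩ := unary_inj _ _ _ _ h
      obtain ⟨h2, h⟩ := unary_inj _ _ _ _ h
      rw [h0, h1, h2, encodeRows_inj l m h]

/-- Different tables have different descriptions. -/
theorem Table.encode_injective : Function.Injective Table.encode := by
  intro S T h
  have h1 := encodeRows_inj _ _ h
  obtain ⟨n, acc, next⟩ := S
  obtain ⟨n', acc', next'⟩ := T
  have hn : n = n' := by
    have := congrArg List.length h1
    simpa using this
  subst hn
  have h2 := List.ofFn_injective h1
  have h3 : acc = acc' := by
    funext q
    exact congrArg Prod.fst (congrFun h2 q)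
  have h4 : next = next' := by
    funext q b
    have hq := congrFun h2 q
    simp only [Table.row, Prod.mk.injEq] at hq
    cases b
    · exact Fin.ext hq.2.1
    · exact Fin.ext hq.2.2
  rw [h3, h4]

/-- The one-state automaton that accepts nothing. -/
def Table.trivial : Table := ⟨0, fun _ => false, fun _ _ => 0⟩

open Classical in
/-- Every binary word describes an automaton: a word that is not the description of a transition
table describes the one-state automaton that accepts nothing. -/
noncomputable def automaton (x : Word) : Table :=
  if h : ∃ T : Table, T.encode = x then h.choose else Table.trivial

theorem automaton_encode (T : Table) : automaton T.encode = T := by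
  have h : ∃ S : Table, S.encode = T.encode := ⟨T, rfl⟩
  rw [automaton, dif_pos h]
  exact Table.encode_injective h.choose_spec

/-- The regular language described by a binary word. -/
noncomputable def lang (x : Word) : Set Word :=
  {v | v ∈ (automaton x).toDFA.accepts}

/-- Number of states of the automaton described by a binary word. -/
noncomputable def numStates (x : Word) : ℕ := (automaton x).n + 1

/-- `x` describes a minimal DFA recognizing the language `R`. -/
def IsMinimalDFA (x : Word) (R : Set Word) : Prop :=
  lang x = R ∧ ∀ y, lang y = R → numStates x ≤ numStates y

/-! ## Regular realizability -/

/-- The regular realizability problem with filter `L`. -/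
def reg (L : Set Word) : Set Word := {x | (L ∩ lang x).Nonempty}

/-- The regular realizability promise problem with filter `L`, where the regular language
described by the instance is promised to belong to the family `F`. -/
def rrPromise (L : Set Word) (F : Set (Set Word)) : PromiseProblem where
  yes := {x | lang x ∈ F ∧ x ∈ reg L}
  no := {x | lang x ∈ F ∧ x ∉ reg L}
  disj := Set.disjoint_left.mpr fun _ h h' => h'.2 h.2

/-- The one-element languages `{w}` with `w ∈ S`. -/
def singletons (S : Set Word) : Set (Set Word) := {R | ∃ w ∈ S, R = {w}}

end RegReal

open RegReal

namespace RegReal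

/-! A DFA with a one-element language `{w}` carries the same information as `w`, and both
translations are cheap. From `w` one writes the chain automaton, whose `w.length + 2` states are the
prefixes of `w` and a sink; `lang_chainTable` and `length_le_numStates` show that it recognizes
`{w}` and is minimal. Conversely, if `lang x = {w}`, then bit `i` of `w` is `b` exactly when some
accepted word has bit `i` equal to `b`. This is a path question about the transition graph, so it
lies in NL (`walk_spec`). Asking it for `i = 0, 1, …` recovers `w`, and the positions of `x` suffice
as indices because `w.length + 2` is at most the number of states, hence at most `x.length`
(`extract_bitOracle`). Under `lang x = {w}`, membership of `x` in `reg L` means `w ∈ L`, and the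
reductions follow.

The main work is to realize these procedures on Turing machines. Each is written as a counter
machine: an input head and one or two counters bounded by `x.length + 1`. Counters are kept in
binary on work tapes, which takes logarithmic space; `toNTM_spec` and `toTransducer_spec` turn a
counter bound into membership in the machine classes. Both simulations rest on
`Forced.exists_of_reachable`: between two memories that represent configurations the low-level
machine has no choice, so every reachable memory lies on a forced path to a representing one. The
same principle lifts the NL machine from its commands to whole guessed letters. -/

/-! ## Forced paths -/

/-- A path along `R` on which every point but the last satisfies `B` and has exactly one
successor. -/
inductive Forced {α : Type*} (R : α → α → Prop) (B : α → Prop) : α → α → Prop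
  | refl (a : α) : Forced R B a a
  | head {a b c : α} : B a → R a b → (∀ b', R a b' → b' = b) → Forced R B b c → Forced R B a c

namespace Forced

variable {α β : Type*} {R : α → α → Prop} {B : α → Prop}

theorem trans {a b c : α} (h : Forced R B a b) (h' : Forced R B b c) : Forced R B a c := by
  induction h with
  | refl => exact h'
  | head hB hR hu _ ih => exact .head hB hR hu (ih h')

theorem reflTransGen {a b : α} (h : Forced R B a b) : Relation.ReflTransGen R a b := by
  induction h with
  | refl => exact .refl
  | head _ hR _ _ ih => exact .head hR ih

/-- Every point that a forced path leaves satisfies `B`. With `B` chosen to exclude acceptance, an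
accepting point must already be the representative at the end of its path. -/
theorem eq_of_not {a b : α} (h : Forced R B a b) (ha : ¬ B a) : a = b := by
  cases h with
  | refl => rfl
  | head hB => exact absurd hB ha

/-- If every step of `R` out of a representative of `b` starts a step of `S` out of `b` that is
completed by a forced path, then every point reachable along `R` is on such a path. -/
theorem exists_of_reachable {S : β → β → Prop} {Rep : β → α → Prop} {b₀ : β} {a₀ : α}
    (h₀ : ∃ a, Rep b₀ a ∧ Forced R B a₀ a)
    (hstep : ∀ b a a', Relation.ReflTransGen S b₀ b → Rep b a → R a a' →
      ∃ b' a'', S b b' ∧ Rep b' a'' ∧ Forced R B a' a'')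
    {a : α} (h : Relation.ReflTransGen R a₀ a) :
    ∃ b a', Relation.ReflTransGen S b₀ b ∧ Rep b a' ∧ Forced R B a a' := by
  induction h with
  | refl =>
    obtain ⟨a, h1, h2⟩ := h₀
    exact ⟨b₀, a, .refl, h1, h2⟩
  | tail _ hR ih =>
    obtain ⟨b, a', hb, hrep, hf⟩ := ih
    cases hf with
    | refl =>
      obtain ⟨b', a'', h1, h2, h3⟩ := hstep b _ _ hb hrep hR
      exact ⟨b', a'', hb.tail h1, h2, h3⟩
    -- In the middle of a forced path the step just taken is the only possible one, so the rest of
    -- the path still leads to the same representative.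
    | head _ _ hu hf =>
      rw [hu _ hR]
      exact ⟨b, a', hb, hrep, hf⟩

end Forced

/-! ## Binary counters as lists of digits, least significant first -/

/-- The number with the given binary digits. -/
def digitsVal : Word → ℕ
  | [] => 0
  | d :: l => d.toNat + 2 * digitsVal l

/-- Increment (`b = true`) or decrement (`b = false`) of a binary number; `none` if the number
to be decremented is zero. -/
def bump (b : Bool) : Word → Option Word
  | [] => if b then some [true] else none
  | d :: l => if d = b then (bump b l).map ((!d) :: ·) else some ((!d) :: l)

/-- A new digit appears only when all digits are one, and then the new value is exactly `2 ^
l.length`. Thus a bound on the values a counter takes bounds its length, although leading zeros are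
never removed by a successful decrement. -/
theorem bump_true (l : Word) : ∃ l', bump true l = some l' ∧ digitsVal l' = digitsVal l + 1 ∧
    (l'.length = l.length ∨ l'.length = l.length + 1 ∧ digitsVal l' = 2 ^ l.length) := by
  induction l with
  | nil => exact ⟨[true], by simp [bump, digitsVal]⟩
  | cons d l ih =>
    obtain ⟨l', h1, h2, h3⟩ := ih
    cases d
    · exact ⟨true :: l, by simp [bump, digitsVal]; omega⟩
    · refine ⟨false :: l', by simp [bump, h1], by simp [digitsVal, h2]; omega, ?_⟩
      simp only [List.length_cons, digitsVal, Bool.toNat_false, pow_succ]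
      omega

theorem bump_false_zero {l : Word} (h : digitsVal l = 0) : bump false l = none := by
  induction l with
  | nil => rfl
  | cons d l ih =>
    cases d <;> simp [digitsVal, bump] at h ⊢
    exact ih h

theorem bump_false_pos {l : Word} (h : digitsVal l ≠ 0) : ∃ l', bump false l = some l' ∧
    digitsVal l' = digitsVal l - 1 ∧ l'.length = l.length := by
  induction l with
  | nil => simp [digitsVal] at h
  | cons d l ih =>
    cases d
    · have h0 : digitsVal l ≠ 0 := by simpa [digitsVal] using h
      obtain ⟨l', h1, h2, h3⟩ := ih h0
      refine ⟨true :: l', by simp [bump, h1], ?_, by simp [h3]⟩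
      simp [digitsVal, h2]
      omega
    · exact ⟨false :: l, by simp [bump, digitsVal]⟩

/-! ## Counters on work tapes -/

/-- Symbols of a work tape that holds a counter: blank, the mark `some none` of the first cell,
or a binary digit. -/
abbrev Cell := Option (Option Bool)

/-- From cell `h` on, the tape contains the digits `l`, followed by blanks. -/
def Holds (t : ℕ → Cell) (h : ℕ) (l : Word) : Prop := ∀ i, t (h + i) = l[i]?.map some

theorem Holds.head {t : ℕ → Cell} {h : ℕ} {l : Word} (H : Holds t h l) :
    t h = l.head?.map some := by
  have := H 0
  rwa [Nat.add_zero, ← List.head?_eq_getElem?] at this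

theorem Holds.tail {t : ℕ → Cell} {h : ℕ} {d : Bool} {l : Word} (H : Holds t h (d :: l)) :
    Holds t (h + 1) l := fun i => by
  have := H (i + 1)
  rwa [List.getElem?_cons_succ, ← Nat.add_assoc, Nat.add_right_comm] at this

theorem Holds.cons {t : ℕ → Cell} {h : ℕ} {d : Bool} {l : Word} (h0 : t h = some (some d))
    (H : Holds t (h + 1) l) : Holds t h (d :: l) := fun i => by
  cases i with
  | zero => simpa using h0
  | succ i => rw [List.getElem?_cons_succ, ← H i]; congr 1; omega

theorem Holds.congr {t t' : ℕ → Cell} {h : ℕ} {l : Word} (H : Holds t h l)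
    (e : ∀ i, h ≤ i → t' i = t i) : Holds t' h l := fun i => by
  rw [e _ (Nat.le_add_right _ _), H i]

/-- The control of a machine that keeps counters on its work tapes: either it is ready for the
next command, or it propagates a carry on tape `j`, or it returns to the first cell. -/
inductive Ctrl (k : ℕ) (σ : Type)
  | idle (q : σ)
  | carry (b : Bool) (j : Fin k) (next fail : σ)
  | back (erase : Bool) (j : Fin k) (q : σ)

instance (k : ℕ) (σ : Type) [Finite σ] : Finite (Ctrl k σ) := by
  let f : σ ⊕ (Bool × Fin k × σ × σ) ⊕ (Bool × Fin k × σ) → Ctrl k σ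
    | .inl q => .idle q
    | .inr (.inl (b, j, q, r)) => .carry b j q r
    | .inr (.inr (b, j, q)) => .back b j q
  refine Finite.of_surjective f ?_
  rintro (q | ⟨b, j, q, r⟩ | ⟨b, j, q⟩)
  · exact ⟨.inl q, rfl⟩
  · exact ⟨.inr (.inl (b, j, q, r)), rfl⟩
  · exact ⟨.inr (.inr (b, j, q)), rfl⟩

/-- An instruction that changes only tape `j`. -/
def tapeInstr {k : ℕ} {σ : Type} (s : σ) (im : Move) (g : Fin k → Cell) (j : Fin k) (c : Cell)
    (mv : Move) : Instr k Cell σ :=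
  ⟨s, im, Function.update g j c, Function.update (fun _ => .stay) j mv⟩

/-- The instructions that carry out the increment or decrement of a counter. -/
def busyInstr {k : ℕ} {σ : Type} (g : Fin k → Cell) : Ctrl k σ → Option (Instr k Cell (Ctrl k σ))
  | .idle _ => none
  | .carry b j q r => some <|
    match g j with
    | some (some d) =>
      tapeInstr (if d = b then .carry b j q r else .back false j q) .stay g j (some (some !d))
        (if d = b then .right else .left)
    | _ =>
      if b then tapeInstr (.back false j q) .stay g j (some (some true)) .left
      else tapeInstr (.back true j r) .stay g j none .left
  | .back e j q => some <|
    match g j with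
    | some none => tapeInstr (.idle q) .stay g j (some none) .stay
    | c => tapeInstr (.back e j q) .stay g j (if e then none else c) .left

/-- One step of the execution of an increment or decrement. -/
def BusyStep {k : ℕ} {σ : Type} (x : Word) (m m' : Memory k Cell (Ctrl k σ)) : Prop :=
  ∃ I, busyInstr m.scan m.state = some I ∧ m' = m.exec x I

/-- A memory all of whose work heads, but the one of tape `j`, are on the first cell. -/
def focus {k : ℕ} {σ : Type} (s : σ) (p : ℕ) (W : Fin k → ℕ → Cell) (j : Fin k) (t : ℕ → Cell)
    (h : ℕ) : Memory k Cell σ :=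
  ⟨s, p, Function.update W j t, Function.update (fun _ => 0) j h⟩

/-! ### Carries and returns on a single work tape. -/

section focus

variable {k : ℕ} {σ : Type} {x : Word} {p : ℕ} {W : Fin k → ℕ → Cell} {j : Fin k}

theorem focus_scan (s : σ) (t : ℕ → Cell) (h : ℕ) : (focus s p W j t h).scan j = t h := by
  simp [focus, Memory.scan]

/-- The other tapes rewrite the symbol they scan and their heads stay, so focused memories are
closed under such instructions and only one tape has to be followed. -/
theorem focus_exec (s s' : σ) (im mv : Move) (t : ℕ → Cell) (h : ℕ) (c : Cell) :
    (focus s p W j t h).exec x (tapeInstr s' im (focus s p W j t h).scan j c mv) =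
      focus s' (min (im.apply p) (x.length + 1)) W j (Function.update t h c) (mv.apply h) := by
  simp only [Memory.exec, tapeInstr, focus, Memory.mk.injEq, true_and]
  constructor
  · funext i
    by_cases hi : i = j
    · subst hi; simp
    · simp [hi, Memory.scan]
  · funext i
    by_cases hi : i = j
    · subst hi; simp
    · simp [hi, Move.apply]

/-- Forced execution of increments and decrements in the first `s + 1` cells. -/
def BusyPath (x : Word) (s : ℕ) : Memory k Cell (Ctrl k σ) → Memory k Cell (Ctrl k σ) → Prop :=
  Forced (BusyStep x) (fun m => ∀ j, m.pos j ≤ s)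

/-- `busyInstr` is a function, which makes the step forced; `hp` makes the clamping of the input
head harmless. -/
theorem BusyPath.head_of_instr {s h : ℕ} {c c' : Ctrl k σ} {t : ℕ → Cell} {d : Cell} {mv : Move}
    {m : Memory k Cell (Ctrl k σ)} (hp : p ≤ x.length + 1) (hs : h ≤ s)
    (hI : busyInstr (focus c p W j t h).scan c =
      some (tapeInstr c' .stay (focus c p W j t h).scan j d mv))
    (hm : BusyPath x s (focus c' p W j (Function.update t h d) (mv.apply h)) m) :
    BusyPath x s (focus c p W j t h) m := by
  have he := focus_exec (x := x) (p := p) (W := W) (j := j) c c' .stay mv t h d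
  rw [Move.apply, min_eq_left hp] at he
  refine .head (fun i => ?_) ⟨_, hI, rfl⟩ ?_ (he ▸ hm)
  · by_cases hi : i = j
    · subst hi; simpa [focus] using hs
    · simp [focus, hi]
  · rintro b ⟨I, h1, rfl⟩
    rw [show (focus c p W j t h).state = c from rfl, hI] at h1
    rw [Option.some.inj h1]

/-- A digit equal to `b` is flipped and passes the carry on; the first other digit absorbs it, or,
for an increment, the blank after the last digit does. Cells before `h` stay intact, which later
protects the mark in cell `0`. -/
theorem carry_some {s : ℕ} (hp : p ≤ x.length + 1) (b : Bool) (q r : σ) (l l' : Word) :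
    ∀ (t : ℕ → Cell) (h : ℕ), bump b l = some l' → 0 < h → h + l.length ≤ s → Holds t h l →
    ∃ t' h', BusyPath x s (focus (.carry b j q r) p W j t h) (focus (.back false j q) p W j t' h') ∧
      (∀ i < h, t' i = t i) ∧ Holds t' h l' ∧ h' < h + l'.length ∧ h' ≤ s := by
  induction l generalizing l' with
  | nil =>
    intro t h hl h0 hs H
    cases b <;> simp [bump] at hl
    subst hl
    have hth : t h = none := by simpa using H.head
    refine ⟨Function.update t h (some (some true)), h - 1, ?_, ?_, ?_, by simp,
      by simp at hs; omega⟩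
    · refine .head_of_instr hp (by simpa using hs) (d := some (some true)) (mv := .left)
        (c' := .back false j q) ?_ (Forced.refl _)
      simp [busyInstr, focus_scan, hth]
    · intro i hi
      rw [Function.update_of_ne hi.ne]
    · refine Holds.cons (by simp) ?_
      intro i
      rw [Function.update_of_ne (by omega), Nat.add_assoc, H]
      simp
  | cons d l ih =>
    intro t h hl h0 hs H
    have hth : t h = some (some d) := by simpa using H.head
    simp only [List.length_cons] at hs
    by_cases hd : d = b
    · subst hd
      simp only [bump, if_true, Option.map_eq_some_iff] at hl
      obtain ⟨l₁, hl₁, rfl⟩ := hl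
      obtain ⟨t', h', h1, h2, h3, h4, h5⟩ := ih l₁ (Function.update t h (some (some !d))) (h + 1)
        hl₁ (by omega) (by omega) (H.tail.congr fun i hi => Function.update_of_ne (by omega) _ _)
      refine ⟨t', h', .head_of_instr hp (by omega) (d := some (some !d)) (mv := .right)
        (c' := .carry d j q r) ?_ h1, ?_, ?_, ?_, h5⟩
      · simp [busyInstr, focus_scan, hth]
      · intro i hi
        rw [h2 i (by omega), Function.update_of_ne (by omega)]
      · exact .cons (by rw [h2 h (by omega)]; simp) h3
      · simp only [List.length_cons]; omega
    · simp only [bump, if_neg hd, Option.some.injEq] at hl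
      subst hl
      refine ⟨Function.update t h (some (some !d)), h - 1, ?_, ?_, ?_, by simp; omega, by omega⟩
      · refine .head_of_instr hp (by omega) (d := some (some !d)) (mv := .left)
          (c' := .back false j q) ?_ (Forced.refl _)
        simp [busyInstr, focus_scan, hth, hd]
      · intro i hi
        rw [Function.update_of_ne hi.ne]
      · exact .cons (by simp) (H.tail.congr fun i hi => Function.update_of_ne (by omega) _ _)

/-- A borrow that runs through all digits discovers that the counter was zero, but it has
overwritten the digits. They are erased on the way back, so only their number matters here. -/
theorem carry_none {s : ℕ} (hp : p ≤ x.length + 1) (b : Bool) (q r : σ) (l : Word) :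
    ∀ (t : ℕ → Cell) (h : ℕ), bump b l = none → 0 < h → h + l.length ≤ s → Holds t h l →
    ∃ t', BusyPath x s (focus (.carry b j q r) p W j t h)
        (focus (.back true j r) p W j t' (h + l.length - 1)) ∧
      (∀ i < h, t' i = t i) ∧ ∃ l', Holds t' h l' ∧ l'.length = l.length := by
  induction l with
  | nil =>
    intro t h hl h0 hs H
    cases b <;> simp [bump] at hl
    have hth : t h = none := by simpa using H.head
    refine ⟨t, ?_, fun _ _ => rfl, [], H, rfl⟩
    refine .head_of_instr hp (by simpa using hs) (d := none) (mv := .left)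
      (c' := .back true j r) ?_ ?_
    · simp [busyInstr, focus_scan, hth]
    · rw [← hth, Function.update_eq_self]
      exact Forced.refl _
  | cons d l ih =>
    intro t h hl h0 hs H
    have hth : t h = some (some d) := by simpa using H.head
    simp only [List.length_cons] at hs
    by_cases hd : d = b
    · subst hd
      simp only [bump, if_true, Option.map_eq_none_iff] at hl
      obtain ⟨t', h1, h2, l', h3, h4⟩ := ih (Function.update t h (some (some !d))) (h + 1)
        hl (by omega) (by omega) (H.tail.congr fun i hi => Function.update_of_ne (by omega) _ _)
      refine ⟨t', .head_of_instr hp (by omega) (d := some (some !d)) (mv := .right)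
        (c' := .carry d j q r) ?_ ?_, ?_, (!d) :: l', ?_, by simp [h4]⟩
      · simp [busyInstr, focus_scan, hth]
      · rw [show h + (d :: l).length - 1 = h + 1 + l.length - 1 by
          rw [List.length_cons]; omega]
        exact h1
      · intro i hi
        rw [h2 i (by omega), Function.update_of_ne (by omega)]
      · exact .cons (by rw [h2 h (by omega)]; simp) h3
    · simp [bump, if_neg hd] at hl

/-- The mark in cell `0` is the only signal that stops the return, so it must not occur in cells `1,
…, h`. -/
theorem back_path {s : ℕ} (hp : p ≤ x.length + 1) (e : Bool) (q : σ) (h : ℕ) :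
    ∀ t : ℕ → Cell, t 0 = some none → (∀ i, 0 < i → i ≤ h → t i ≠ some none) → h ≤ s →
    ∃ t', BusyPath x s (focus (.back e j q) p W j t h) (focus (.idle q) p W j t' 0) ∧
      ∀ i, 0 < i → t' i = if e = true ∧ i ≤ h then none else t i := by
  induction h with
  | zero =>
    intro t h0 _ hs
    refine ⟨t, .head_of_instr hp hs (d := some none) (mv := .stay) (c' := .idle q) ?_ ?_, ?_⟩
    · simp [busyInstr, focus_scan, h0]
    · rw [← h0, Function.update_eq_self]
      exact Forced.refl _
    · intro i hi
      rw [if_neg (by omega)]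
  | succ h ih =>
    intro t h0 hne hs
    obtain ⟨t', h1, h2⟩ := ih (Function.update t (h + 1) (if e then none else t (h + 1)))
      (by rw [Function.update_of_ne (by omega), h0])
      (fun i hi hi' => by rw [Function.update_of_ne (by omega)]; exact hne i hi (by omega))
      (by omega)
    refine ⟨t', .head_of_instr hp hs (mv := .left) ?_ h1, ?_⟩
    · have := hne (h + 1) (by omega) le_rfl
      simp only [busyInstr, focus_scan]
    · intro i hi
      rw [h2 i hi]
      rcases lt_trichotomy i (h + 1) with hi' | rfl | hi'
      · rw [Function.update_of_ne (by omega)]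
        simp [Nat.lt_succ_iff.1 hi', hi'.le]
      · cases e <;> simp
      · rw [Function.update_of_ne (by omega), if_neg (by omega), if_neg (by omega)]

end focus

/-! ## Counter machines -/

/-- A command of a counter machine: it moves the input head, may increment (`(j, true)`) or
decrement (`(j, false)`) a counter, and continues in state `fail` if the counter to be decremented
is zero and in state `next` otherwise. -/
structure Cmd (k : ℕ) (σ : Type) where
  next : σ
  fail : σ := next
  inMove : Move := .stay
  op : Option (Fin k × Bool) := none
  out : Option Bool := none
  oracle : OracleAct := .idle

/-- A machine with a read-only input tape and `k` counters. The Boolean argument of `cmd` is the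
last answer of an oracle or a nondeterministic guess. -/
structure CounterMachine where
  k : ℕ
  σ : Type
  finσ : Finite σ
  start : σ
  cmd : σ → InSym → Bool → Option (Cmd k σ)

/-- State, position of the input head, and counters. -/
structure CState (k : ℕ) (σ : Type) where
  state : σ
  inPos : ℕ
  cnt : Fin k → ℕ

section

variable {k : ℕ} {σ : Type}

/-- The state in which a command leaves the machine. -/
def Cmd.target (I : Cmd k σ) (c : Fin k → ℕ) : σ :=
  match I.op with
  | some (j, false) => if c j = 0 then I.fail else I.next
  | _ => I.next

/-- The counters after a command. -/
def Cmd.count (I : Cmd k σ) (c : Fin k → ℕ) : Fin k → ℕ :=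
  match I.op with
  | none => c
  | some (j, b) => Function.update c j (if b then c j + 1 else c j - 1)

/-- Execution of a command on input `x`. -/
def CState.exec (x : Word) (C : CState k σ) (I : Cmd k σ) : CState k σ where
  state := I.target C.cnt
  inPos := min (I.inMove.apply C.inPos) (x.length + 1)
  cnt := I.count C.cnt

/-- The first instruction in the execution of a command. -/
def Cmd.toInstr (I : Cmd k σ) (g : Fin k → Cell) : Instr k Cell (Ctrl k σ) :=
  match I.op with
  | none => ⟨.idle I.next, I.inMove, g, fun _ => .stay⟩
  | some (j, b) => tapeInstr (.carry b j I.next I.fail) I.inMove g j (some none) .right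

/-- The memory `m` of a Turing machine represents the configuration `C`. -/
structure Represents (x : Word) (C : CState k σ) (m : Memory k Cell (Ctrl k σ)) : Prop where
  state : m.state = .idle C.state
  inPos : m.inPos = C.inPos
  le : C.inPos ≤ x.length + 1
  pos : m.pos = fun _ => 0
  cnt : ∀ j, ∃ l, Holds (m.work j) 1 l ∧ digitsVal l = C.cnt j ∧
    l.length ≤ Nat.log 2 (x.length + 1) + 1

theorem Represents.init (x : Word) (q : σ) :
    Represents x (⟨q, 0, fun _ => 0⟩ : CState k σ) (Memory.init (.idle q) none) :=
  ⟨rfl, rfl, Nat.zero_le _, rfl, fun _ => ⟨[], fun i => by simp [Memory.init], rfl, Nat.zero_le _⟩⟩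

/-- A command is executed by its first instruction followed by forced steps. -/
theorem Represents.exec {x : Word} {C : CState k σ} {m : Memory k Cell (Ctrl k σ)}
    (H : Represents x C m) (I : Cmd k σ) (hb : ∀ j, (C.exec x I).cnt j ≤ x.length + 1) :
    ∃ m', Represents x (C.exec x I) m' ∧
      BusyPath x (Nat.log 2 (x.length + 1) + 2) (m.exec x (I.toInstr m.scan)) m' := by
  obtain ⟨s, p, W, h⟩ := m
  obtain ⟨h1, h2, h3, h4, h5⟩ := H
  simp only at h1 h2 h4 h5
  subst h1 h2 h4
  obtain ⟨q, r, im, op, out, oracle⟩ := I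
  have hp : min (im.apply C.inPos) (x.length + 1) ≤ x.length + 1 := min_le_right _ _
  rcases op with _ | ⟨j, b⟩
  · refine ⟨_, ⟨rfl, rfl, hp, ?_, ?_⟩, Forced.refl _⟩
    · funext i
      simp [Memory.exec, Cmd.toInstr, Move.apply]
    · intro i
      obtain ⟨l, hl, hl'⟩ := h5 i
      refine ⟨l, ?_, hl'⟩
      simpa [Memory.exec, Cmd.toInstr, Memory.scan] using hl
  have hm : (⟨.idle C.state, C.inPos, W, fun _ => 0⟩ : Memory k Cell (Ctrl k σ)) =
      focus (.idle C.state) C.inPos W j (W j) 0 := by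
    rw [focus, Function.update_eq_self]
    congr 1
    exact (Function.update_eq_self j (fun _ : Fin k => 0)).symm
  obtain ⟨l, hl, hv, hlen⟩ := h5 j
  have hl' : Holds (Function.update (W j) 0 (some none)) 1 l :=
    hl.congr fun i hi => Function.update_of_ne (by omega) _ _
  have hbj := hb j
  simp only [CState.exec, Cmd.count, Function.update_self] at hbj
  -- Both outcomes of the carry phase in one statement: `e = false` if the tape holds the new value,
  -- `e = true` if a decrement of zero failed. In the latter case the digits are garbage, and it
  -- suffices that the return starts at or beyond the last of them.
  have key : ∃ t' l' h' e, BusyPath x (Nat.log 2 (x.length + 1) + 2)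
      (focus (.carry b j q r) (min (im.apply C.inPos) (x.length + 1)) W j
        (Function.update (W j) 0 (some none)) 1)
      (focus (.back e j ((⟨q, r, im, some (j, b), out, oracle⟩ : Cmd k σ).target C.cnt))
        (min (im.apply C.inPos) (x.length + 1)) W j t' h') ∧ t' 0 = some none ∧
      Holds t' 1 l' ∧ l'.length ≤ Nat.log 2 (x.length + 1) + 1 ∧ h' ≤ Nat.log 2 (x.length + 1) + 2 ∧
      (e = false → digitsVal l' = if b then C.cnt j + 1 else C.cnt j - 1) ∧
      (e = true → (if b then C.cnt j + 1 else C.cnt j - 1) = 0 ∧ l'.length ≤ h') := by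
    by_cases hz : b = false ∧ C.cnt j = 0
    · obtain ⟨rfl, hz⟩ := hz
      obtain ⟨t', ht, h0, l', hl'', hle⟩ := carry_none (W := W) (j := j)
        (s := Nat.log 2 (x.length + 1) + 2) hp false q r l _ 1
        (bump_false_zero (hv.trans hz)) one_pos (by omega) hl'
      refine ⟨t', l', 1 + l.length - 1, true, ?_, by simp [h0], hl'', by omega, by omega, by simp, ?_⟩
      · simpa only [Cmd.target, hz, if_true] using ht
      · intro _
        simp [hz]
        omega
    · have : ∃ l', bump b l = some l' ∧ digitsVal l' = (if b then C.cnt j + 1 else C.cnt j - 1) ∧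
          l'.length ≤ Nat.log 2 (x.length + 1) + 1 := by
        cases b
        · obtain ⟨l', a1, a2, a3⟩ := bump_false_pos (l := l) (by rw [hv]; simpa using hz)
          exact ⟨l', a1, by simp [a2, hv], by omega⟩
        · obtain ⟨l', a1, a2, a3⟩ := bump_true l
          refine ⟨l', a1, by simp [a2, hv], ?_⟩
          -- If the number gets longer, its new value `2 ^ l.length` is at most `x.length + 1` by
          -- `hbj`, so the old length is at most the logarithm.
          rcases a3 with a3 | ⟨a3, a4⟩
          · omega
          · rw [a2, hv] at a4
            rw [if_pos rfl, a4] at hbj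
            have := Nat.le_log_of_pow_le one_lt_two hbj
            omega
      obtain ⟨l', a1, a2, a3⟩ := this
      obtain ⟨t', h', b1, b2, b3, b4, b5⟩ := carry_some (W := W) (j := j)
        (s := Nat.log 2 (x.length + 1) + 2) hp b q r l l' _ 1 a1 one_pos (by omega) hl'
      refine ⟨t', l', h', false, ?_, by simp [b2], b3, a3, b5, fun _ => a2, by simp⟩
      convert b1 using 2
      cases b
      · simp only [true_and] at hz
        simp [Cmd.target, hz]
      · rfl
  obtain ⟨t₁, l₁, h₁, e, p1, z1, H1, len1, s1, f1, g1⟩ := key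
  obtain ⟨t₂, p2, H2⟩ := back_path (W := W) (j := j) (s := Nat.log 2 (x.length + 1) + 2) hp e
    ((⟨q, r, im, some (j, b), out, oracle⟩ : Cmd k σ).target C.cnt) h₁ t₁ z1
    (fun i hi _ => by
      obtain ⟨i, rfl⟩ := Nat.exists_eq_succ_of_ne_zero hi.ne'
      rw [Nat.succ_eq_add_one, Nat.add_comm, H1]
      cases l₁[i]? <;> simp) s1
  refine ⟨focus _ _ W j t₂ 0, ⟨rfl, rfl, hp, ?_, ?_⟩, ?_⟩
  · exact Function.update_eq_self j (fun _ : Fin k => 0)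
  · intro i
    by_cases hi : i = j
    · subst hi
      simp only [focus, Function.update_self, CState.exec, Cmd.count]
      cases e
      · exact ⟨l₁, H1.congr fun n hn => by rw [H2 n hn]; simp, f1 rfl, len1⟩
      · obtain ⟨g2, g3⟩ := g1 rfl
        -- After the erasure the tape is blank from cell `1` on, which is the empty list of digits
        -- with value zero.
        refine ⟨[], fun n => ?_, g2.symm, Nat.zero_le _⟩
        rw [H2 _ (by omega), H1]
        simp only [true_and]
        split
        · rfl
        · rw [List.getElem?_eq_none (by omega), List.getElem?_nil]
    · obtain ⟨l, hl, hl'⟩ := h5 i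
      exact ⟨l, by simpa [focus, hi] using hl, by simpa [CState.exec, Cmd.count, hi] using hl'⟩
  · rw [hm]
    simp only [Cmd.toInstr, focus_exec]
    exact p1.trans p2

end

/-- For `n > 0` one has `n + 1 ≤ 2 * n`, so the left side is at most `Nat.log 2 n + 3`; the constant
`4` leaves room for this. -/
theorem log_space_bound (n : ℕ) : Nat.log 2 (n + 1) + 2 < logBound 4 n := by
  have h : Nat.log 2 (n + 1) ≤ Nat.log 2 n + 1 := by
    rcases Nat.eq_zero_or_pos n with rfl | hn
    · simp
    · rw [← Nat.log_mul_base one_lt_two hn.ne']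
      exact Nat.log_mono_right (by omega)
  unfold logBound
  omega

namespace CounterMachine

variable (M : CounterMachine)

/-- The start configuration. -/
def init : CState M.k M.σ := ⟨M.start, 0, fun _ => 0⟩

/-! ### Nondeterministic counter machines -/

/-- A step with an arbitrary guess. -/
def Step (x : Word) (C C' : CState M.k M.σ) : Prop :=
  ∃ a I, M.cmd C.state (inputAt x C.inPos) a = some I ∧ C' = C.exec x I

/-- The configurations that occur on input `x`. -/
def Reachable (x : Word) (C : CState M.k M.σ) : Prop := Relation.ReflTransGen (M.Step x) M.init C

/-- The Turing machine that simulates `M`. -/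
abbrev toNTM (acc : M.σ) : NTM where
  k := M.k
  Γ := Cell
  σ := Ctrl M.k M.σ
  finΓ := inferInstance
  finσ := have := M.finσ; inferInstance
  blank := none
  start := .idle M.start
  accept := {.idle acc}
  trans s i g :=
    match s with
    | .idle q => {J | ∃ a I, M.cmd q i a = some I ∧ J = I.toInstr g}
    | s => {J | busyInstr g s = some J}

/-- Nondeterminism is confined to idle control states; elsewhere the set of possible instructions is
a singleton. -/
theorem toNTM_busy (acc : M.σ) {x : Word} {m m' : Memory M.k Cell (Ctrl M.k M.σ)}
    (h : BusyStep x m m') :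
    (M.toNTM acc).Step x m m' ∧ ∀ m'', (M.toNTM acc).Step x m m'' → m'' = m' := by
  obtain ⟨I, hI, rfl⟩ := h
  have ht : (M.toNTM acc).trans m.state (inputAt x m.inPos) m.scan = {J | some I = some J} := by
    rw [← hI]
    cases hs : m.state with
    | idle q => rw [hs] at hI; simp [busyInstr] at hI
    | carry b j q r => rfl
    | back e j q => rfl
  refine ⟨⟨I, ht ▸ rfl, rfl⟩, ?_⟩
  rintro m'' ⟨J, hJ, rfl⟩
  rw [ht] at hJ
  rw [Option.some.inj hJ]

/-- The predicate along forced paths says both that the memory is not accepting and that its heads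
are in bounds. Each reachable memory either satisfies it or represents a reachable configuration
itself, which gives the space bound and soundness of acceptance at once. -/
theorem toNTM_spec (acc : M.σ) (hb : ∀ x C, M.Reachable x C → ∀ j, C.cnt j ≤ x.length + 1) :
    (M.toNTM acc).LogSpace ∧
      ∀ x, (M.toNTM acc).Accepts x ↔ ∃ C, M.Reachable x C ∧ C.state = acc := by
  have hmap : ∀ x {m m'}, BusyPath x (Nat.log 2 (x.length + 1) + 2) m m' →
      Forced ((M.toNTM acc).Step x) (fun m => (m.state ∉ (M.toNTM acc).accept) ∧
        ∀ j, m.pos j ≤ Nat.log 2 (x.length + 1) + 2) m m' := by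
    intro x m m' h
    induction h with
    | refl => exact .refl _
    | head h1 h2 _ _ ih =>
      refine .head ⟨?_, h1⟩ (M.toNTM_busy acc h2).1 (M.toNTM_busy acc h2).2 ih
      rintro (h : _ = _)
      obtain ⟨I, hI, -⟩ := h2
      rw [h] at hI
      simp [busyInstr] at hI
  have hsim : ∀ x m, (M.toNTM acc).Reachable x m → ∃ C m', M.Reachable x C ∧ Represents x C m' ∧
      Forced ((M.toNTM acc).Step x) (fun m => (m.state ∉ (M.toNTM acc).accept) ∧
        ∀ j, m.pos j ≤ Nat.log 2 (x.length + 1) + 2) m m' := by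
    intro x m hm
    refine Forced.exists_of_reachable (Rep := Represents x)
      ⟨_, Represents.init x M.start, .refl _⟩ ?_ hm
    rintro C m m' hC hrep ⟨J, hJ, rfl⟩
    rw [hrep.state, hrep.inPos] at hJ
    obtain ⟨a, I, hI, rfl⟩ := hJ
    have hs : M.Step x C (C.exec x I) := ⟨a, I, hI, rfl⟩
    obtain ⟨m', h1, h2⟩ := hrep.exec I (hb x _ (hC.tail hs))
    exact ⟨_, m', hs, h1, hmap x h2⟩
  have hfwd : ∀ x C, M.Reachable x C → ∃ m, (M.toNTM acc).Reachable x m ∧ Represents x C m := by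
    intro x C hC
    induction hC with
    | refl => exact ⟨_, .refl, Represents.init x M.start⟩
    | @tail C C' hC hs ih =>
      obtain ⟨m, hm, hrep⟩ := ih
      have hs' := hs
      obtain ⟨a, I, hI, rfl⟩ := hs
      obtain ⟨m', h1, h2⟩ := hrep.exec I (hb x _ (hC.tail hs'))
      refine ⟨m', (hm.tail ⟨I.toInstr m.scan, ?_, rfl⟩).trans (hmap x h2).reflTransGen, h1⟩
      rw [hrep.state, hrep.inPos]
      exact ⟨a, I, hI, rfl⟩
  refine ⟨⟨4, fun x m hm j => ?_⟩, fun x => ⟨?_, ?_⟩⟩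
  · refine lt_of_le_of_lt ?_ (log_space_bound x.length)
    obtain ⟨C, m', -, hrep, hf⟩ := hsim x m hm
    cases hf with
    | refl => rw [hrep.pos]; exact Nat.zero_le _
    | head h => exact h.2 j
  · rintro ⟨m, hm, ha⟩
    obtain ⟨C, m', hC, hrep, hf⟩ := hsim x m hm
    obtain rfl := hf.eq_of_not fun h => h.1 ha
    refine ⟨C, hC, ?_⟩
    rw [hrep.state] at ha
    exact Ctrl.idle.inj ha
  · rintro ⟨C, hC, rfl⟩
    obtain ⟨m, hm, hrep⟩ := hfwd x C hC
    exact ⟨m, hm, hrep.state⟩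

/-! ### Deterministic counter machines with output and oracle -/

/-- A configuration of a counter machine with output and oracle. -/
structure TConf (k : ℕ) (σ : Type) where
  core : CState k σ
  out : Word
  query : Word
  answer : Bool

/-- The oracle tape after a command. -/
def _root_.RegReal.OracleAct.apply : OracleAct → Word → Word
  | .idle, u => u
  | .write b, u => u ++ [b]
  | .query, _ => []

open Classical in
/-- The oracle answer after a command, with oracle `O`. -/
noncomputable def _root_.RegReal.OracleAct.reply (O : Set Word) : OracleAct → Word → Bool → Bool
  | .query, u, _ => decide (u ∈ O)
  | _, _, a => a

/-- Execution of a command with oracle `O`. -/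
noncomputable def TConf.exec {k : ℕ} {σ : Type} (O : Set Word) (x : Word) (C : TConf k σ)
    (I : Cmd k σ) : TConf k σ where
  core := C.core.exec x I
  out := C.out ++ I.out.toList
  query := I.oracle.apply C.query
  answer := I.oracle.reply O C.query C.answer

/-- The command that is executed next. -/
def current (x : Word) (C : TConf M.k M.σ) : Option (Cmd M.k M.σ) :=
  M.cmd C.core.state (inputAt x C.core.inPos) C.answer

/-- A step of the computation with oracle `O`. -/
def OStep (O : Set Word) (x : Word) (C C' : TConf M.k M.σ) : Prop :=
  ∃ I, M.current x C = some I ∧ C' = C.exec O x I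

/-- The configurations that occur on input `x`, with oracle `O`. -/
def OReachable (O : Set Word) (x : Word) (C : TConf M.k M.σ) : Prop :=
  Relation.ReflTransGen (M.OStep O x) ⟨M.init, [], [], false⟩ C

/-- An instruction that leaves the output and the oracle tape alone. -/
def _root_.RegReal.Instr.quiet {k : ℕ} {Γ σ : Type} (I : Instr k Γ σ) : TInstr k Γ σ :=
  ⟨I, none, .idle⟩

/-- The transducer that simulates `M`. -/
abbrev toTransducer : Transducer where
  k := M.k
  Γ := Cell
  σ := Ctrl M.k M.σ
  finΓ := inferInstance
  finσ := have := M.finσ; inferInstance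
  blank := none
  start := .idle M.start
  trans s i g a :=
    match s with
    | .idle q => (M.cmd q i a).map fun I => ⟨I.toInstr g, I.out, I.oracle⟩
    | s => (busyInstr g s).map Instr.quiet

theorem toTransducer_oracleFree (h : ∀ q s a I, M.cmd q s a = some I → I.oracle = .idle) :
    M.toTransducer.OracleFree := by
  intro s i g a J hJ
  cases s with
  | idle q =>
    obtain ⟨I, hI, rfl⟩ := Option.map_eq_some_iff.1 hJ
    exact h _ _ _ _ hI
  | carry b j q r =>
    change (busyInstr g (.carry b j q r)).map Instr.quiet = some J at hJ
    obtain ⟨I, hI, rfl⟩ := Option.map_eq_some_iff.1 hJ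
    rfl
  | back e j q =>
    change (busyInstr g (.back e j q)).map Instr.quiet = some J at hJ
    obtain ⟨I, hI, rfl⟩ := Option.map_eq_some_iff.1 hJ
    rfl

theorem toTransducer_busy (O : Set Word) {x : Word} {m m' : Memory M.k Cell (Ctrl M.k M.σ)}
    (o u : Word) (a : Bool) (h : BusyStep x m m') :
    M.toTransducer.Step O x ⟨m, o, u, a⟩ ⟨m', o, u, a⟩ := by
  obtain ⟨I, hI, rfl⟩ := h
  refine ⟨I.quiet, ?_, ?_⟩
  · cases hs : m.state with
    | idle q => rw [hs] at hI; simp [busyInstr] at hI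
    | carry b j q r =>
      rw [hs] at hI
      simp only [Transducer.current, hs]
      exact Option.map_eq_some_iff.2 ⟨I, hI, rfl⟩
    | back e j q =>
      rw [hs] at hI
      simp only [Transducer.current, hs]
      exact Option.map_eq_some_iff.2 ⟨I, hI, rfl⟩
  · simp [Transducer.exec, Instr.quiet]

theorem _root_.RegReal.Transducer.Step.unique {M : Transducer} {O : Set Word} {x : Word}
    {C C' C'' : M.Config} (h : M.Step O x C C') (h' : M.Step O x C C'') : C'' = C' := by
  obtain ⟨I, hI, rfl⟩ := h
  obtain ⟨J, hJ, rfl⟩ := h'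
  rw [hI] at hJ
  rw [Option.some.inj hJ]

/-- Output and oracle actions belong to the first instruction of a command. The forced steps after
it change only the work tapes, the control state and the work heads, so output, query and answer
agree with those of the counter machine at its end. -/
theorem toTransducer_spec (O : Set Word) (f : Word → Word)
    (hb : ∀ x C, M.OReachable O x C → ∀ j, C.core.cnt j ≤ x.length + 1)
    (hf : ∀ x, ∃ C, M.OReachable O x C ∧ M.current x C = none ∧ C.out = f x) :
    M.toTransducer.LogSpaceComputes O f := by
  let B (x : Word) (c : M.toTransducer.Config) : Prop :=
    ∀ j, c.mem.pos j ≤ Nat.log 2 (x.length + 1) + 2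
  let Rep (x : Word) (C : TConf M.k M.σ) (c : M.toTransducer.Config) : Prop :=
    Represents x C.core c.mem ∧ c.out = C.out ∧ c.query = C.query ∧ c.answer = C.answer
  have hmap : ∀ x o u a {m m'}, BusyPath x (Nat.log 2 (x.length + 1) + 2) m m' →
      Forced (M.toTransducer.Step O x) (B x) ⟨m, o, u, a⟩ ⟨m', o, u, a⟩ := by
    intro x o u a m m' h
    induction h with
    | refl => exact .refl _
    | head h1 h2 _ _ ih =>
      exact .head h1 (M.toTransducer_busy O o u a h2)
        (fun _ h => Transducer.Step.unique (M.toTransducer_busy O o u a h2) h) ih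
  have hcur : ∀ x C c, Rep x C c → M.toTransducer.current x c =
      (M.current x C).map fun I => ⟨I.toInstr c.mem.scan, I.out, I.oracle⟩ := by
    rintro x C c ⟨hrep, -, -, ha⟩
    simp only [Transducer.current, hrep.state, hrep.inPos, ha]
    rfl
  have hstep : ∀ x C c I, M.OReachable O x C → Rep x C c → M.current x C = some I →
      ∃ c', Rep x (C.exec O x I) c' ∧ Forced (M.toTransducer.Step O x) (B x)
        (M.toTransducer.exec O x c ⟨I.toInstr c.mem.scan, I.out, I.oracle⟩) c' := by
    rintro x C c I hC ⟨hrep, ho, hq, ha⟩ hI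
    obtain ⟨m', h1, h2⟩ := hrep.exec I (hb x _ (hC.tail ⟨I, hI, rfl⟩))
    refine ⟨⟨m', _, _, _⟩, ⟨h1, ?_, ?_, ?_⟩, hmap x _ _ _ h2⟩
    · simp only [TConf.exec, ho]
    · simp only [TConf.exec, hq]
      cases I.oracle <;> rfl
    · simp only [TConf.exec, ha]
      cases I.oracle <;> simp [OracleAct.reply, hq]
  have h0 : ∀ x, Rep x ⟨M.init, [], [], false⟩ M.toTransducer.init := fun x =>
    ⟨Represents.init x M.start, rfl, rfl, rfl⟩
  refine ⟨⟨4, fun x c hc j => ?_⟩, fun x => ?_⟩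
  · refine lt_of_le_of_lt ?_ (log_space_bound x.length)
    obtain ⟨C, c', hC, hrep, hfo⟩ := Forced.exists_of_reachable (B := B x) (S := M.OStep O x)
      (Rep := Rep x) ⟨_, h0 x, .refl _⟩ (by
        rintro C c c' hC hrep ⟨J, hJ, rfl⟩
        rw [hcur x C c hrep] at hJ
        obtain ⟨I, hI, rfl⟩ := Option.map_eq_some_iff.1 hJ
        obtain ⟨c', h1, h2⟩ := hstep x C c I hC hrep hI
        exact ⟨_, c', ⟨I, hI, rfl⟩, h1, h2⟩) hc
    cases hfo with
    | refl => rw [hrep.1.pos]; exact Nat.zero_le _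
    | head h => exact h j
  · have hfwd : ∀ C, M.OReachable O x C → ∃ c, M.toTransducer.Reachable O x c ∧ Rep x C c := by
      intro C hC
      induction hC with
      | refl => exact ⟨_, .refl, h0 x⟩
      | @tail C C' hC hs ih =>
        obtain ⟨c, hc, hrep⟩ := ih
        obtain ⟨I, hI, rfl⟩ := hs
        obtain ⟨c', h1, h2⟩ := hstep x C c I hC hrep hI
        refine ⟨c', (hc.tail ⟨_, ?_, rfl⟩).trans h2.reflTransGen, h1⟩
        rw [hcur x C c hrep, hI]
        rfl
    obtain ⟨C, hC, hn, ho⟩ := hf x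
    obtain ⟨c, hc, hrep⟩ := hfwd C hC
    refine ⟨c, hc, ?_, hrep.2.1.trans ho⟩
    rw [hcur x C c hrep, hn]
    rfl

end CounterMachine

/-! ## Reading the input -/

theorem inputAt_eq_left {x : Word} {i : ℕ} : inputAt x i = .left ↔ i = 0 := by
  unfold inputAt
  split_ifs with h
  · simp [h]
  · split <;> simp [h]

theorem inputAt_succ {x : Word} {i : ℕ} (h : i < x.length) : inputAt x (i + 1) = .bit x[i] := by
  simp [inputAt, h]

theorem inputAt_end (x : Word) : inputAt x (x.length + 1) = .right := by
  simp [inputAt]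

theorem inputAt_bit {x : Word} {i : ℕ} {b : Bool} (h : inputAt x i = .bit b) :
    0 < i ∧ i ≤ x.length := by
  unfold inputAt at h
  split_ifs at h with h0
  split at h
  · rename_i b' hb
    have := (List.getElem?_eq_some_iff.1 hb).1
    omega
  · cases h

/-! ## Machines with one counter -/

namespace CounterMachine

section

variable {σ : Type} (cmd : σ → InSym → Bool → Option (Cmd 1 σ))

/-- A configuration of a machine with one counter. -/
def conf (q : σ) (p n : ℕ) (o u : Word) (a : Bool) : TConf 1 σ := ⟨⟨q, p, fun _ => n⟩, o, u, a⟩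

/-- The value of the only counter after a command. -/
def _root_.RegReal.Cmd.count₁ (I : Cmd 1 σ) (n : ℕ) : ℕ :=
  match I.op with
  | none => n
  | some (_, true) => n + 1
  | some (_, false) => n - 1

theorem conf_exec (O : Set Word) (x : Word) (q : σ) (p n : ℕ) (o u : Word) (a : Bool)
    (I : Cmd 1 σ) : (conf q p n o u a).exec O x I =
      conf (I.target fun _ => n) (min (I.inMove.apply p) (x.length + 1)) (I.count₁ n)
        (o ++ I.out.toList) (I.oracle.apply u) (I.oracle.reply O u a) := by
  simp only [TConf.exec, CState.exec, conf, TConf.mk.injEq, CState.mk.injEq, true_and, and_true]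
  funext i
  rw [Subsingleton.elim i 0]
  obtain ⟨_, _, _, _ | ⟨j, b⟩, _, _⟩ := I
  · rfl
  · rw [Subsingleton.elim j 0]
    cases b <;> simp [Cmd.count, Cmd.count₁]

end

theorem OReachable.step {M : CounterMachine} {O : Set Word} {x : Word} {C D : TConf M.k M.σ}
    (I : Cmd M.k M.σ) (h : M.current x C = some I)
    (h' : Relation.ReflTransGen (M.OStep O x) (C.exec O x I) D) :
    Relation.ReflTransGen (M.OStep O x) C D := .head ⟨I, h, rfl⟩ h'

end CounterMachine

open CounterMachine

/-! ## The chain automaton of a word -/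

/-- States of the machine that writes the description of the chain automaton. -/
inductive ChainState
  | main
  | save (b : Bool)
  | right (b : Bool)
  | left (b : Bool)
  | rest (b : Bool)
  | rest' (b : Bool)
  | done (b : Bool)
  | finL (s : Bool)
  | finR (s : Bool)
  | mid
  | halt
  deriving Fintype

/-- The commands of the machine that writes the description of the chain automaton. On an input
bit `b` at position `i` the position is saved in the counter while the input head moves to the left
end; then the head moves to the right end and back, and is restored to position `i`. During these
moves the blocks of ones of a row are written. -/
def chainCmd : ChainState → InSym → Bool → Option (Cmd 1 ChainState)
  | .main, .left, _ => some { next := .main, inMove := .right }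
  | .main, .bit b, _ => some { next := .save b, out := some false }
  | .main, .right, _ => some { next := .finL false, out := some true }
  | .save b, .left, _ => some { next := .right b, out := if b then none else some false }
  | .save b, _, _ => some { next := .save b, inMove := .left, op := some (0, true),
                            out := if b then none else some true }
  | .right b, .right, _ => some { next := .left b, out := some false }
  | .right b, _, _ => some { next := .right b, inMove := .right, out := some true }
  | .left b, .left, _ => some { next := .rest b }
  | .left b, _, _ => some { next := .left b, inMove := .left }
  | .rest b, _, _ => some { next := .rest' b, fail := .done b, op := some (0, false) }
  | .rest' b, _, _ => some { next := .rest b, inMove := .right,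
                             out := if b then some true else none }
  | .done b, _, _ => some { next := .main, inMove := .right, out := if b then some false else none }
  | .finL s, .left, _ => some { next := .finR s, out := some false }
  | .finL s, _, _ => some { next := .finL s, inMove := .left, out := some true }
  | .finR s, .right, _ => some { next := if s then .halt else .mid, out := some false }
  | .finR s, _, _ => some { next := .finR s, inMove := .right, out := some true }
  | .mid, _, _ => some { next := .finL true, out := some false }
  | .halt, _, _ => none

/-- The machine that writes the description of the chain automaton. -/
abbrev chainMachine : CounterMachine := ⟨1, ChainState, inferInstance, .main, chainCmd⟩

theorem chainMachine_bound (O : Set Word) (x : Word) (C : TConf 1 ChainState)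
    (h : chainMachine.OReachable O x C) (j : Fin 1) : C.core.cnt j ≤ x.length + 1 := by
  -- The counter grows only in state `save`, where each increment is paid for by a left move of the
  -- head, so `n + p` does not grow. The state is entered with the counter at zero, as the last
  -- clause records.
  suffices H : ∃ q p n o u a, C = conf q p n o u a ∧ p ≤ x.length + 1 ∧ n ≤ x.length + 1 ∧
      match q with
      | .save _ => n + p ≤ x.length + 1
      | .right _ | .left _ | .rest _ | .rest' _ => True
      | _ => n = 0 by
    obtain ⟨q, p, n, o, u, a, rfl, -, h, -⟩ := H
    exact h
  induction h with
  | refl => exact ⟨.main, 0, 0, [], [], false, rfl, by simp⟩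
  | tail _ hs ih =>
    obtain ⟨q, p, n, o, u, a, rfl, hp, hn, H⟩ := ih
    obtain ⟨I, hI, rfl⟩ := hs
    rw [conf_exec]
    refine ⟨_, _, _, _, _, _, rfl, min_le_right _ _, ?_⟩
    simp only [current, conf] at hI
    have hl := @inputAt_eq_left x p
    generalize inputAt x p = s at hI hl
    cases q <;> cases s <;> simp only [chainCmd, Option.some.injEq, reduceCtorEq] at hI <;>
      subst hI <;> simp [Cmd.target, Cmd.count₁, Move.apply] at * <;>
      first | omega | (by_cases h0 : n = 0 <;> simp [h0] <;> first | omega | (split <;> trivial))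

/-! ### Runs of the machine that writes the chain automaton. -/

section chain

variable {O : Set Word} {x : Word}

/-- A configuration of the machine that writes the description of the chain automaton. -/
def chainConf (q : ChainState) (p n : ℕ) (o : Word) : TConf 1 ChainState := conf q p n o [] false

theorem chain_step {q q' : ChainState} {p p' n n' : ℕ} {o o' : Word} {D : TConf 1 ChainState}
    (I : Cmd 1 ChainState) (hI : chainCmd q (inputAt x p) false = some I)
    (hq : I.target (fun _ => n) = q') (hp : min (I.inMove.apply p) (x.length + 1) = p')
    (hn : I.count₁ n = n') (ho : o ++ I.out.toList = o') (hO : I.oracle = .idle)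
    (h : Relation.ReflTransGen (chainMachine.OStep O x) (chainConf q' p' n' o') D) :
    Relation.ReflTransGen (chainMachine.OStep O x) (chainConf q p n o) D := by
  refine OReachable.step I hI ?_
  rw [chainConf, conf_exec, hq, hp, hn, ho, hO]
  exact h

theorem chain_save (b : Bool) (p : ℕ) : ∀ n o, p ≤ x.length + 1 →
    Relation.ReflTransGen (chainMachine.OStep O x) (chainConf (.save b) p n o)
      (chainConf (.save b) 0 (n + p) (o ++ if b then [] else List.replicate p true)) := by
  induction p with
  | zero => intro n o _; simpa using Relation.ReflTransGen.refl
  | succ p ih =>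
    intro n o hp
    have hs : inputAt x (p + 1) ≠ .left := fun h => by simp [inputAt_eq_left] at h
    refine chain_step (q' := .save b) (p' := p) (n' := n + 1)
      (o' := o ++ if b then [] else [true])
      { next := .save b, inMove := .left, op := some (0, true),
        out := if b then none else some true } ?_ rfl ?_ rfl ?_ rfl ?_
    · generalize inputAt x (p + 1) = s at hs
      cases s <;> first | rfl | contradiction
    · simp [Move.apply]; omega
    · cases b <;> rfl
    · convert ih (n + 1) _ (by omega) using 2
      · omega
      · cases b <;> simp [List.replicate_succ]

theorem chain_right (b : Bool) (n : ℕ) (d : ℕ) : ∀ p o, p + d = x.length + 1 →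
    Relation.ReflTransGen (chainMachine.OStep O x) (chainConf (.right b) p n o)
      (chainConf (.right b) (x.length + 1) n (o ++ List.replicate d true)) := by
  induction d with
  | zero => rintro p o rfl; simpa using Relation.ReflTransGen.refl
  | succ d ih =>
    intro p o hp
    refine chain_step (q' := .right b) (p' := p + 1) (n' := n) (o' := o ++ [true])
      { next := .right b, inMove := .right, out := some true } ?_ rfl ?_ rfl rfl rfl ?_
    · rcases p with _ | p
      · rfl
      · rw [inputAt_succ (by omega)]; rfl
    · simp [Move.apply]; omega
    · convert ih (p + 1) _ (by omega) using 2
      simp [List.replicate_succ]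

theorem chain_left (b : Bool) (n : ℕ) (o : Word) (p : ℕ) (hp : p ≤ x.length + 1) :
    Relation.ReflTransGen (chainMachine.OStep O x) (chainConf (.left b) p n o)
      (chainConf (.left b) 0 n o) := by
  induction p with
  | zero => exact .refl
  | succ p ih =>
    have hs : inputAt x (p + 1) ≠ .left := fun h => by simp [inputAt_eq_left] at h
    refine chain_step (q' := .left b) (p' := p) (n' := n) (o' := o)
      { next := .left b, inMove := .left } ?_ rfl ?_ rfl (by simp) rfl (ih (by omega))
    · generalize inputAt x (p + 1) = s at hs
      cases s <;> first | rfl | contradiction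
    · simp [Move.apply]; omega

theorem chain_rest (b : Bool) (n : ℕ) : ∀ p o, p + n ≤ x.length + 1 →
    Relation.ReflTransGen (chainMachine.OStep O x) (chainConf (.rest b) p n o)
      (chainConf (.done b) (p + n) 0 (o ++ if b then List.replicate n true else [])) := by
  induction n with
  | zero =>
    intro p o hp
    refine chain_step (q' := .done b) (p' := p) (n' := 0) (o' := o)
      { next := .rest' b, fail := .done b, op := some (0, false) } rfl rfl ?_ rfl (by simp) rfl ?_
    · simpa [Move.apply] using hp
    · simpa using Relation.ReflTransGen.refl
  | succ n ih =>
    intro p o hp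
    refine chain_step (q' := .rest' b) (p' := p) (n' := n) (o' := o)
      { next := .rest' b, fail := .done b, op := some (0, false) } rfl rfl ?_ rfl (by simp) rfl ?_
    · simp [Move.apply]; omega
    refine chain_step (q' := .rest b) (p' := p + 1) (n' := n) (o' := o ++ if b then [true] else [])
      { next := .rest b, inMove := .right, out := if b then some true else none }
      rfl rfl ?_ rfl ?_ rfl ?_
    · simp [Move.apply]; omega
    · cases b <;> rfl
    · convert ih (p + 1) _ (by omega) using 2
      · omega
      · cases b <;> simp [List.replicate_succ]

theorem chain_finL (s : Bool) (p : ℕ) : ∀ o, p ≤ x.length + 1 →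
    Relation.ReflTransGen (chainMachine.OStep O x) (chainConf (.finL s) p 0 o)
      (chainConf (.finL s) 0 0 (o ++ List.replicate p true)) := by
  induction p with
  | zero => intro o _; simpa using Relation.ReflTransGen.refl
  | succ p ih =>
    intro o hp
    have hs : inputAt x (p + 1) ≠ .left := fun h => by simp [inputAt_eq_left] at h
    refine chain_step (q' := .finL s) (p' := p) (n' := 0) (o' := o ++ [true])
      { next := .finL s, inMove := .left, out := some true } ?_ rfl ?_ rfl rfl rfl ?_
    · generalize inputAt x (p + 1) = s at hs
      cases s <;> first | rfl | contradiction
    · simp [Move.apply]; omega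
    · convert ih _ (by omega) using 2
      simp [List.replicate_succ]

theorem chain_finR (s : Bool) (d : ℕ) : ∀ p o, p + d = x.length + 1 →
    Relation.ReflTransGen (chainMachine.OStep O x) (chainConf (.finR s) p 0 o)
      (chainConf (.finR s) (x.length + 1) 0 (o ++ List.replicate d true)) := by
  induction d with
  | zero => rintro p o rfl; simpa using Relation.ReflTransGen.refl
  | succ d ih =>
    intro p o hp
    refine chain_step (q' := .finR s) (p' := p + 1) (n' := 0) (o' := o ++ [true])
      { next := .finR s, inMove := .right, out := some true } ?_ rfl ?_ rfl rfl rfl ?_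
    · rcases p with _ | p
      · rfl
      · rw [inputAt_succ (by omega)]; rfl
    · simp [Move.apply]; omega
    · convert ih (p + 1) _ (by omega) using 2
      simp [List.replicate_succ]

/-- The row of state `i` of the chain automaton of `x`. State `x.length + 1` is the sink. -/
def chainRow (x : Word) (i : ℕ) : Bool × ℕ × ℕ :=
  (decide (i = x.length), if x[i]? = some false then i + 1 else x.length + 1,
    if x[i]? = some true then i + 1 else x.length + 1)

/-- The letter `x[i]` sits in cell `i + 1`, and `i + 1` is also the state it leads to; the sweep
across the whole input has length `x.length + 1`, the number of the sink. So head moves produce both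
blocks. For the letter `0` the short block comes first and is written while saving the position; for
`1` it comes second and is written while restoring it. -/
theorem chain_row (i : ℕ) (o : Word) (hi : i < x.length) :
    Relation.ReflTransGen (chainMachine.OStep O x) (chainConf .main (i + 1) 0 o)
      (chainConf .main (i + 2) 0 (o ++ encodeRow (chainRow x i))) := by
  obtain ⟨b, hb⟩ : ∃ b, b = x[i] := ⟨_, rfl⟩
  refine chain_step (q' := .save b) (p' := i + 1) (n' := 0) (o' := o ++ [false])
    { next := .save b, out := some false } ?_ rfl ?_ rfl rfl rfl ?_
  · rw [inputAt_succ hi, ← hb]; rfl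
  · simp [Move.apply]; omega
  refine (chain_save b (i + 1) _ _ (by omega)).trans ?_
  refine chain_step (q' := .right b) (p' := 0) (o' := o ++ [false] ++
    (if b then [] else List.replicate (i + 1) true) ++ if b then [] else [false])
    { next := .right b, out := if b then none else some false } rfl rfl rfl rfl ?_ rfl ?_
  · cases b <;> rfl
  refine (chain_right b _ (x.length + 1) _ _ (by omega)).trans ?_
  refine chain_step (q' := .left b) (p' := x.length + 1)
    { next := .left b, out := some false } ?_ rfl (by simp [Move.apply]) rfl rfl rfl ?_
  · rw [inputAt_end]; rfl
  refine (chain_left b _ _ _ le_rfl).trans ?_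
  refine chain_step (q' := .rest b) (p' := 0) { next := .rest b } rfl rfl rfl rfl rfl rfl ?_
  refine (chain_rest b _ _ _ (by simp [Cmd.count₁]; omega)).trans ?_
  refine chain_step (q' := .main) (p' := i + 2)
    { next := .main, inMove := .right, out := if b then some false else none }
    rfl rfl ?_ rfl ?_ rfl .refl
  · simp [Move.apply, Cmd.count₁]; omega
  · have : x[i]? = some b := by simp [hb, hi]
    have h' : i ≠ x.length := hi.ne
    cases b <;> simp [encodeRow, chainRow, this, h', Cmd.count₁, List.replicate_succ]

theorem chain_rows (i : ℕ) (hi : i ≤ x.length) :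
    Relation.ReflTransGen (chainMachine.OStep O x) (chainConf .main 0 0 [])
      (chainConf .main (i + 1) 0 ((List.range i).flatMap fun i => encodeRow (chainRow x i))) := by
  induction i with
  | zero =>
    exact chain_step (q' := .main) (p' := 1) (n' := 0) (o' := [])
      { next := .main, inMove := .right } rfl rfl (by simp [Move.apply]) rfl rfl rfl .refl
  | succ i ih =>
    refine (ih (by omega)).trans ?_
    simpa [List.range_succ] using chain_row i
      ((List.range i).flatMap fun i => encodeRow (chainRow x i)) (by omega)

/-- In the last two rows both successors are the sink, so the rows differ only in the acceptance
bit. The flag of `finL` and `finR` tells which one is being written. -/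
theorem chain_final (o : Word) :
    Relation.ReflTransGen (chainMachine.OStep O x) (chainConf .main (x.length + 1) 0 o)
      (chainConf .halt (x.length + 1) 0 (o ++ encodeRow (chainRow x x.length) ++
        encodeRow (chainRow x (x.length + 1)))) := by
  refine chain_step (q' := .finL false) (p' := x.length + 1)
    { next := .finL false, out := some true } ?_ rfl (by simp [Move.apply]) rfl rfl rfl ?_
  · rw [inputAt_end]; rfl
  refine (chain_finL _ _ _ le_rfl).trans ?_
  refine chain_step (q' := .finR false) (p' := 0)
    { next := .finR false, out := some false } rfl rfl rfl rfl rfl rfl ?_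
  refine (chain_finR _ (x.length + 1) _ _ (by omega)).trans ?_
  refine chain_step (q' := .mid) (p' := x.length + 1)
    { next := .mid, out := some false } ?_ rfl (by simp [Move.apply]) rfl rfl rfl ?_
  · rw [inputAt_end]; rfl
  refine chain_step (q' := .finL true) (p' := x.length + 1)
    { next := .finL true, out := some false } rfl rfl (by simp [Move.apply]) rfl rfl rfl ?_
  refine (chain_finL _ _ _ le_rfl).trans ?_
  refine chain_step (q' := .finR true) (p' := 0)
    { next := .finR true, out := some false } rfl rfl rfl rfl rfl rfl ?_
  refine (chain_finR _ (x.length + 1) _ _ (by omega)).trans ?_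
  refine chain_step (q' := .halt) (p' := x.length + 1)
    { next := .halt, out := some false } ?_ rfl (by simp [Move.apply]) rfl ?_ rfl .refl
  · rw [inputAt_end]; rfl
  · simp [encodeRow, chainRow]

end chain

/-- The chain automaton of `w`: state `i ≤ w.length` is reached by the prefix of `w` of length
`i`, and state `w.length + 1` is a sink. -/
def chainTable (w : Word) : Table where
  n := w.length + 1
  acc q := decide (q.val = w.length)
  next q b := ⟨if w[q.val]? = some b then q.val + 1 else w.length + 1, by
    split_ifs with h
    · have := (List.getElem?_eq_some_iff.1 h).1
      omega
    · omega⟩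

theorem chainTable_encode (w : Word) : (chainTable w).encode =
    ((List.range w.length).flatMap fun i => encodeRow (chainRow w i)) ++
      encodeRow (chainRow w w.length) ++ encodeRow (chainRow w (w.length + 1)) := by
  have h : List.ofFn (chainTable w).row = (List.range (w.length + 2)).map (chainRow w) := by
    refine List.ext_getElem (by simp [chainTable]) fun i h1 h2 => ?_
    rw [List.getElem_ofFn, List.getElem_map, List.getElem_range]
    rfl
  rw [Table.encode, h, List.range_succ, List.range_succ]
  simp [List.flatMap_map]

theorem FL_chainTable : FL fun w => (chainTable w).encode := by
  refine ⟨chainMachine.toTransducer, chainMachine.toTransducer_oracleFree ?_,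
    chainMachine.toTransducer_spec ∅ _ (chainMachine_bound ∅) fun x => ?_⟩
  · intro q s a I h
    cases q <;> cases s <;> simp only [chainCmd, Option.some.injEq, reduceCtorEq] at h <;>
      subst h <;> rfl
  · refine ⟨_, (chain_rows x.length le_rfl).trans (chain_final _), ?_, ?_⟩
    · rfl
    · exact (chainTable_encode x).symm

/-! ## Extracting a word bit by bit with an oracle -/

/-- States of the machine that extracts a word. -/
inductive QueryState
  | ask (b : Bool)
  | save (b : Bool)
  | right (b : Bool)
  | left (b : Bool)
  | rest (b : Bool)
  | rest' (b : Bool)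
  | done (b : Bool)
  deriving Fintype

/-- The commands of the machine that extracts a word. At position `i + 1` of the input `x` it asks
the queries `bitQuery b i x`; the position is saved in the counter in the meantime. -/
def queryCmd : QueryState → InSym → Bool → Option (Cmd 1 QueryState)
  | .ask b, .left, _ => some { next := .ask b, inMove := .right }
  | .ask b, .bit _, _ => some { next := .save b, oracle := .write b }
  | .ask _, .right, _ => none
  | .save b, .left, _ => some { next := .right b, inMove := .right, oracle := .write false }
  | .save b, _, _ => some { next := .save b, inMove := .left, op := some (0, true),
                            oracle := .write true }
  | .right b, .bit c, _ => some { next := .right b, inMove := .right, oracle := .write c }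
  | .right b, .right, _ => some { next := .left b, oracle := .query }
  | .right _, .left, _ => none
  | .left b, .left, _ => some { next := .rest b }
  | .left b, _, _ => some { next := .left b, inMove := .left }
  | .rest b, _, _ => some { next := .rest' b, fail := .done b, op := some (0, false) }
  | .rest' b, _, _ => some { next := .rest b, inMove := .right }
  | .done b, _, true => some { next := .ask false, inMove := .right, out := some b }
  | .done false, _, false => some { next := .ask true }
  | .done true, _, false => none

/-- The machine that extracts a word. -/
abbrev queryMachine : CounterMachine := ⟨1, QueryState, inferInstance, .ask false, queryCmd⟩

theorem queryMachine_bound (O : Set Word) (x : Word) (C : TConf 1 QueryState)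
    (h : queryMachine.OReachable O x C) (j : Fin 1) : C.core.cnt j ≤ x.length + 1 := by
  suffices H : ∃ q p n o u a, C = conf q p n o u a ∧ p ≤ x.length + 1 ∧ n ≤ x.length + 1 ∧
      match q with
      | .save _ => n + p ≤ x.length + 1
      | .ask _ | .done _ => n = 0
      | _ => True by
    obtain ⟨q, p, n, o, u, a, rfl, -, h, -⟩ := H
    exact h
  induction h with
  | refl => exact ⟨.ask false, 0, 0, [], [], false, rfl, by simp⟩
  | tail _ hs ih =>
    obtain ⟨q, p, n, o, u, a, rfl, hp, hn, H⟩ := ih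
    obtain ⟨I, hI, rfl⟩ := hs
    rw [conf_exec]
    refine ⟨_, _, _, _, _, _, rfl, min_le_right _ _, ?_⟩
    simp only [current, conf] at hI
    have hl := @inputAt_eq_left x p
    generalize inputAt x p = s at hI hl
    rcases q with b | b | b | b | b | b | (_ | _) <;> cases s <;> cases a <;>
      simp only [queryCmd, Option.some.injEq, reduceCtorEq] at hI <;>
      subst hI <;> simp [Cmd.target, Cmd.count₁, Move.apply] at * <;>
      first | omega | (by_cases h0 : n = 0 <;> simp [h0]; omega)

/-- The question whether the bit `i` of the word extracted from `x` is `b`. -/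
def bitQuery (b : Bool) (i : ℕ) (x : Word) : Word :=
  b :: (List.replicate (i + 1) true ++ false :: x)

open Classical in
/-- The bit `i` according to the oracle. -/
noncomputable def oracleBit (O : Set Word) (x : Word) (i : ℕ) : Option Bool :=
  if bitQuery false i x ∈ O then some false
  else if bitQuery true i x ∈ O then some true else none

/-- The bits from `x.length - d` on according to the oracle, up to position `x.length` or the
first missing one. -/
noncomputable def extractFrom (O : Set Word) (x : Word) : ℕ → Word
  | 0 => []
  | d + 1 =>
    match oracleBit O x (x.length - (d + 1)) with
    | some b => b :: extractFrom O x d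
    | none => []

/-- The word extracted from `x` with oracle `O`. -/
noncomputable def extract (O : Set Word) (x : Word) : Word := extractFrom O x x.length

/-- With such an oracle each lookup returns `w[i]?`, and the extraction stops at the end of `w`. The
bound `hw` is needed because the positions of `x` serve as indices. -/
theorem extract_eq {O : Set Word} {x w : Word} (hw : w.length ≤ x.length)
    (h : ∀ b i, bitQuery b i x ∈ O ↔ w[i]? = some b) : extract O x = w := by
  have hbit : ∀ i, oracleBit O x i = w[i]? := by
    intro i
    unfold oracleBit
    rw [h, h]
    rcases w[i]? with _ | _ | _ <;> simp
  have key : ∀ d ≤ x.length, extractFrom O x d = w.drop (x.length - d) := by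
    intro d
    induction d with
    | zero => intro _; simp [extractFrom, hw]
    | succ d ih =>
      intro hd
      rw [extractFrom, hbit, ih (by omega)]
      rcases lt_or_ge (x.length - (d + 1)) w.length with hlt | hge
      · rw [List.getElem?_eq_getElem hlt, List.drop_eq_getElem_cons hlt]
        simp only
        congr 2
        omega
      · rw [List.getElem?_eq_none hge, List.drop_eq_nil_of_le hge]
  rw [extract, key _ le_rfl, Nat.sub_self, List.drop_zero]

/-! ### Runs of the machine that extracts a word. -/

section query

variable {O : Set Word} {x : Word}

theorem query_step {q q' : QueryState} {p p' n n' : ℕ} {o o' u u' : Word} {a a' : Bool}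
    {D : TConf 1 QueryState} (I : Cmd 1 QueryState) (hI : queryCmd q (inputAt x p) a = some I)
    (hq : I.target (fun _ => n) = q') (hp : min (I.inMove.apply p) (x.length + 1) = p')
    (hn : I.count₁ n = n') (ho : o ++ I.out.toList = o') (hu : I.oracle.apply u = u')
    (ha : I.oracle.reply O u a = a')
    (h : Relation.ReflTransGen (queryMachine.OStep O x) (conf q' p' n' o' u' a') D) :
    Relation.ReflTransGen (queryMachine.OStep O x) (conf q p n o u a) D := by
  refine OReachable.step I hI ?_
  rw [conf_exec, hq, hp, hn, ho, hu, ha]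
  exact h

theorem query_save (b a : Bool) (o : Word) (p : ℕ) : ∀ n u, p ≤ x.length + 1 →
    Relation.ReflTransGen (queryMachine.OStep O x) (conf (.save b) p n o u a)
      (conf (.save b) 0 (n + p) o (u ++ List.replicate p true) a) := by
  induction p with
  | zero => intro n u _; simpa using Relation.ReflTransGen.refl
  | succ p ih =>
    intro n u hp
    have hs : inputAt x (p + 1) ≠ .left := fun h => by simp [inputAt_eq_left] at h
    refine query_step (q' := .save b) (p' := p) (n' := n + 1) (u' := u ++ [true]) (a' := a)
      { next := .save b, inMove := .left, op := some (0, true), oracle := .write true }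
      ?_ rfl ?_ rfl (List.append_nil o) rfl rfl ?_
    · generalize inputAt x (p + 1) = s at hs
      cases s <;> first | rfl | contradiction
    · simp [Move.apply]; omega
    · convert ih (n + 1) _ (by omega) using 2
      · omega
      · simp [List.replicate_succ]

theorem query_right (b a : Bool) (o : Word) (n d : ℕ) : ∀ p u, p + d = x.length →
    Relation.ReflTransGen (queryMachine.OStep O x) (conf (.right b) (p + 1) n o u a)
      (conf (.right b) (x.length + 1) n o (u ++ x.drop p) a) := by
  induction d with
  | zero => rintro p u rfl; simpa using Relation.ReflTransGen.refl
  | succ d ih =>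
    intro p u hp
    refine query_step (q' := .right b) (p' := p + 2) (n' := n)
      (u' := u ++ [x[p]'(by omega)]) (a' := a)
      { next := .right b, inMove := .right, oracle := .write (x[p]'(by omega)) }
      ?_ rfl ?_ rfl (List.append_nil o) rfl rfl ?_
    · rw [inputAt_succ (by omega)]; rfl
    · simp [Move.apply]; omega
    · convert ih (p + 1) _ (by omega) using 2
      rw [List.drop_eq_getElem_cons (show p < x.length by omega)]
      simp

theorem query_left (b a : Bool) (o u : Word) (n p : ℕ) (hp : p ≤ x.length + 1) :
    Relation.ReflTransGen (queryMachine.OStep O x) (conf (.left b) p n o u a)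
      (conf (.left b) 0 n o u a) := by
  induction p with
  | zero => exact .refl
  | succ p ih =>
    have hs : inputAt x (p + 1) ≠ .left := fun h => by simp [inputAt_eq_left] at h
    refine query_step (q' := .left b) (p' := p) (n' := n)
      { next := .left b, inMove := .left } ?_ rfl ?_ rfl (List.append_nil o) rfl rfl (ih (by omega))
    · generalize inputAt x (p + 1) = s at hs
      cases s <;> first | rfl | contradiction
    · simp [Move.apply]; omega

theorem query_rest (b a : Bool) (o u : Word) (n : ℕ) : ∀ p, p + n ≤ x.length + 1 →
    Relation.ReflTransGen (queryMachine.OStep O x) (conf (.rest b) p n o u a)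
      (conf (.done b) (p + n) 0 o u a) := by
  induction n with
  | zero =>
    intro p hp
    refine query_step (q' := .done b) (p' := p) (n' := 0)
      { next := .rest' b, fail := .done b, op := some (0, false) } rfl rfl ?_ rfl
      (List.append_nil o) rfl rfl .refl
    simpa [Move.apply] using hp
  | succ n ih =>
    intro p hp
    refine query_step (q' := .rest' b) (p' := p) (n' := n)
      { next := .rest' b, fail := .done b, op := some (0, false) } rfl rfl ?_ rfl
      (List.append_nil o) rfl rfl ?_
    · simp [Move.apply]; omega
    refine query_step (q' := .rest b) (p' := p + 1) (n' := n)
      { next := .rest b, inMove := .right } rfl rfl ?_ rfl (List.append_nil o) rfl rfl ?_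
    · simp [Move.apply]; omega
    · rw [← Nat.add_assoc, Nat.add_right_comm]
      exact ih (p + 1) (by omega)

open Classical in
-- The trip to the left marker both saves the position and writes `i + 1` ones; the trip to the
-- right copies `x` behind the separating zero. After the query the counter brings the head back,
-- and the oracle tape is empty for the next round.
theorem query_round (b a : Bool) (o : Word) (i : ℕ) (hi : i < x.length) :
    Relation.ReflTransGen (queryMachine.OStep O x) (conf (.ask b) (i + 1) 0 o [] a)
      (conf (.done b) (i + 1) 0 o [] (decide (bitQuery b i x ∈ O))) := by
  refine query_step (q' := .save b) (p' := i + 1) (n' := 0)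
    { next := .save b, oracle := .write b } ?_ rfl ?_ rfl (List.append_nil o) rfl rfl ?_
  · rw [inputAt_succ hi]; rfl
  · simp [Move.apply]; omega
  refine (query_save b a o (i + 1) _ _ (by omega)).trans ?_
  refine query_step (q' := .right b) (p' := 0 + 1) (n' := i + 1)
    { next := .right b, inMove := .right, oracle := .write false }
    rfl rfl (by simp [Move.apply]) (Nat.zero_add _) (List.append_nil o) rfl rfl ?_
  refine (query_right b a o _ x.length 0 _ (Nat.zero_add _)).trans ?_
  refine query_step (q' := .left b) (p' := x.length + 1) (n' := i + 1) (u' := [])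
    (a' := decide (bitQuery b i x ∈ O))
    { next := .left b, oracle := .query } ?_ rfl (by simp [Move.apply]) rfl (List.append_nil o)
    rfl ?_ ?_
  · rw [inputAt_end]; rfl
  · simp [OracleAct.reply, OracleAct.apply, bitQuery]
    rfl
  refine (query_left b _ o _ _ _ le_rfl).trans ?_
  refine query_step (q' := .rest b) (p' := 0) (n' := i + 1) (u' := [])
    (a' := decide (bitQuery b i x ∈ O)) { next := .rest b } rfl rfl rfl rfl
    (List.append_nil o) rfl rfl ?_
  simpa using query_rest b _ o [] (i + 1) 0 (by omega)

theorem query_extract (d : ℕ) : ∀ o a, d ≤ x.length → ∃ C,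
    Relation.ReflTransGen (queryMachine.OStep O x)
      (conf (.ask false) (x.length - d + 1) 0 o [] a) C ∧
    queryMachine.current x C = none ∧ C.out = o ++ extractFrom O x d := by
  classical
  induction d with
  | zero =>
    intro o a _
    refine ⟨_, .refl, ?_, by simp [extractFrom, conf]⟩
    simp [current, conf, inputAt_end, queryCmd]
  | succ d ih =>
    intro o a hd
    have hi : x.length - (d + 1) < x.length := by omega
    have hnext : ∀ (b : Bool) o', Relation.ReflTransGen (queryMachine.OStep O x)
        (conf (.done b) (x.length - (d + 1) + 1) 0 o' [] true)
        (conf (.ask false) (x.length - d + 1) 0 (o' ++ [b]) [] true) := by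
      intro b o'
      refine query_step (q' := .ask false) (p' := x.length - d + 1)
        { next := .ask false, inMove := .right, out := some b }
        ?_ rfl ?_ rfl rfl rfl rfl .refl
      · cases b <;> rfl
      · simp [Move.apply]; omega
    have h0 := query_round (O := O) (x := x) false a o _ hi
    unfold extractFrom oracleBit
    by_cases hf : bitQuery false (x.length - (d + 1)) x ∈ O
    · rw [decide_eq_true hf] at h0
      obtain ⟨C, h1, h2, h3⟩ := ih (o ++ [false]) true (by omega)
      exact ⟨C, (h0.trans (hnext _ _)).trans h1, h2, by simp [h3, hf]⟩
    rw [decide_eq_false hf] at h0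
    have h1 : Relation.ReflTransGen (queryMachine.OStep O x)
        (conf (.ask false) (x.length - (d + 1) + 1) 0 o [] a)
        (conf (.ask true) (x.length - (d + 1) + 1) 0 o [] false) := by
      refine h0.trans (query_step { next := .ask true } rfl rfl ?_ rfl (List.append_nil o)
        rfl rfl .refl)
      simp [Move.apply]
    replace h1 := h1.trans (query_round true false o _ hi)
    by_cases ht : bitQuery true (x.length - (d + 1)) x ∈ O
    · rw [decide_eq_true ht] at h1
      obtain ⟨C, h2, h3, h4⟩ := ih (o ++ [true]) true (by omega)
      exact ⟨C, (h1.trans (hnext _ _)).trans h2, h3, by simp [h4, hf, ht]⟩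
    -- Two negative answers mean that there is no further bit; the machine halts in state `done
    -- true`.
    · rw [decide_eq_false ht] at h1
      exact ⟨_, h1, rfl, by simp [hf, ht, conf]⟩

end query

theorem FNL_extract {O : Set Word} (hO : NL O) : FNL (extract O) := by
  refine ⟨queryMachine.toTransducer, O, hO,
    queryMachine.toTransducer_spec O _ (queryMachine_bound O) fun x => ?_⟩
  obtain ⟨C, h1, h2, h3⟩ := query_extract (O := O) (x := x) x.length [] false le_rfl
  refine ⟨C, .trans ?_ h1, h2, h3⟩
  rw [Nat.sub_self]
  exact query_step (q := .ask false) (p := 0) (n := 0) (o := []) (u := []) (a := false)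
    { next := .ask false, inMove := .right } rfl rfl (by simp [Move.apply]) rfl rfl rfl rfl .refl

/-! ## A nondeterministic machine for the bits of accepted words -/

/-- States of the machine that guesses an accepted word. The argument `some b` means that the word
read so far does not contain the bit in question yet, which has to be `b`; the argument `none`
means that the bit in question was right. -/
inductive WalkState
  | init
  | skip (b : Bool)
  | load (b : Bool)
  | row (f : Option Bool)
  | fetch (c : Bool) (f : Option Bool)
  | pass (f : Option Bool)
  | count (f : Option Bool)
  | rewind (f : Option Bool)
  | header (f : Option Bool)
  | header' (f : Option Bool)
  | seek (f : Option Bool)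
  | row₀ (f : Option Bool)
  | row₁ (f : Option Bool)
  | row₂ (f : Option Bool)
  | yes
  deriving Fintype

/-- The commands of the machine that, on input `bitQuery b i T.encode`, guesses a word accepted by
`T` whose bit `i` is `b`. Counter `1` is the number of letters that precede this bit. In state
`row` the head is at the beginning of the row of the current state of `T`; the number of the next
state is read into counter `0`, and its row is found by counting rows from the first one. -/
def walkCmd : WalkState → InSym → Bool → Option (Cmd 2 WalkState)
  | .init, .left, _ => some { next := .init, inMove := .right }
  | .init, .bit b, _ => some { next := .skip b, inMove := .right }
  | .skip b, .bit _, _ => some { next := .load b, inMove := .right }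
  | .load b, .bit true, _ => some { next := .load b, inMove := .right, op := some (1, true) }
  | .load b, .bit false, _ => some { next := .row (some b), inMove := .right }
  | .row (some b), _, a => some { next := .fetch a (some b), fail := .fetch b none,
                                  op := some (1, false) }
  | .row none, .bit true, _ => some { next := .yes }
  | .row none, .bit false, a => some { next := .fetch a none }
  | .fetch c f, .bit _, _ => some { next := if c then .pass f else .count f, inMove := .right }
  | .pass f, .bit true, _ => some { next := .pass f, inMove := .right }
  | .pass f, .bit false, _ => some { next := .count f, inMove := .right }
  | .count f, .bit true, _ => some { next := .count f, inMove := .right, op := some (0, true) }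
  | .count f, .bit false, _ => some { next := .rewind f }
  | .rewind f, .left, _ => some { next := .header f, inMove := .right }
  | .rewind f, _, _ => some { next := .rewind f, inMove := .left }
  | .header f, .bit _, _ => some { next := .header' f, inMove := .right }
  | .header' f, .bit true, _ => some { next := .header' f, inMove := .right }
  | .header' f, .bit false, _ => some { next := .seek f, inMove := .right }
  | .seek f, _, _ => some { next := .row₀ f, fail := .row f, op := some (0, false) }
  | .row₀ f, .bit _, _ => some { next := .row₁ f, inMove := .right }
  | .row₁ f, .bit true, _ => some { next := .row₁ f, inMove := .right }
  | .row₁ f, .bit false, _ => some { next := .row₂ f, inMove := .right }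
  | .row₂ f, .bit true, _ => some { next := .row₂ f, inMove := .right }
  | .row₂ f, .bit false, _ => some { next := .seek f, inMove := .right }
  | _, _, _ => none

/-- The machine that guesses an accepted word. -/
abbrev walkMachine : CounterMachine := ⟨2, WalkState, inferInstance, .init, walkCmd⟩

/-- A configuration of the machine that guesses an accepted word. -/
def walkConf (q : WalkState) (p m n : ℕ) : CState 2 WalkState := ⟨q, p, ![m, n]⟩

/-- The two counters after a command. -/
def Cmd.count₂ {σ : Type} (I : Cmd 2 σ) (m n : ℕ) : ℕ × ℕ :=
  match I.op with
  | none => (m, n)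
  | some (0, b) => (if b then m + 1 else m - 1, n)
  | some (1, b) => (m, if b then n + 1 else n - 1)

theorem walkConf_exec (y : Word) (q : WalkState) (p m n : ℕ) (I : Cmd 2 WalkState) :
    (walkConf q p m n).exec y I = walkConf (I.target ![m, n])
      (min (I.inMove.apply p) (y.length + 1)) (I.count₂ m n).1 (I.count₂ m n).2 := by
  simp only [CState.exec, walkConf, CState.mk.injEq, true_and]
  obtain ⟨_, _, _, _ | ⟨j, b⟩, _, _⟩ := I
  · rfl
  · funext i
    fin_cases j <;> fin_cases i <;> simp [Cmd.count, Cmd.count₂]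

theorem walkMachine_bound (y : Word) (C : CState 2 WalkState) (h : walkMachine.Reachable y C)
    (j : Fin 2) : C.cnt j ≤ y.length + 1 := by
  -- The invariant must hold on arbitrary inputs, not only on well-formed queries. A counter grows
  -- only together with a right move off an input bit, so it stays below the head position during
  -- `load` and `count`; and `count` is entered only with counter `0` at zero.
  suffices H : ∃ q p m n, C = walkConf q p m n ∧ p ≤ y.length + 1 ∧ m ≤ y.length + 1 ∧
      n ≤ y.length + 1 ∧
      match q with
      | .init | .skip _ | .load _ => m = 0 ∧ n ≤ p
      | .row _ | .fetch _ _ | .pass _ => m = 0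
      | .count _ => m ≤ p
      | _ => True by
    obtain ⟨q, p, m, n, rfl, -, h1, h2, -⟩ := H
    fin_cases j
    · exact h1
    · exact h2
  induction h with
  | refl =>
    refine ⟨.init, 0, 0, 0, ?_, by simp⟩
    simp only [CounterMachine.init, walkConf, CState.mk.injEq, true_and]
    funext i
    fin_cases i <;> rfl
  | tail _ hs ih =>
    obtain ⟨q, p, m, n, rfl, hp, hm, hn, H⟩ := ih
    obtain ⟨a, I, hI, rfl⟩ := hs
    rw [walkConf_exec]
    refine ⟨_, _, _, _, rfl, min_le_right _ _, ?_⟩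
    simp only [walkConf] at hI
    have hb : ∀ b, inputAt y p = .bit b → p ≤ y.length := fun b hb => (inputAt_bit hb).2
    generalize inputAt y p = s at hI hb
    have hb' : (∃ b, s = .bit b) → p ≤ y.length := fun ⟨b, h⟩ => hb b h
    clear hb
    rcases q with _ | b | b | (_ | b) | ⟨_ | _, f⟩ | f | f | f | f | f | f | f | f | f | _ <;>
      rcases s with _ | (_ | _) | _ <;>
      simp only [walkCmd, Option.some.injEq, reduceCtorEq] at hI <;>
      subst hI <;> simp [Cmd.target, Cmd.count₂, Move.apply] at * <;>
      first | omega | (split <;> simp_all <;> omega) |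
        (by_cases h0 : n = 0 <;> by_cases h1 : m = 0 <;> simp_all <;> omega)

/-! ### Navigation in the transition table. -/

section walk

variable {y : Word}

/-- Forced paths of the machine that guesses an accepted word. -/
abbrev WalkPath (y : Word) : CState 2 WalkState → CState 2 WalkState → Prop :=
  Forced (walkMachine.Step y) (fun C => C.state ≠ .yes)

/-- The command must not depend on the guess `a`; this is what makes the step forced. -/
theorem WalkPath.step {q q' : WalkState} {p p' m m' n n' : ℕ} {D : CState 2 WalkState}
    (I : Cmd 2 WalkState) (hI : ∀ a, walkCmd q (inputAt y p) a = some I) (hq : q ≠ .yes)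
    (ht : I.target ![m, n] = q') (hp : min (I.inMove.apply p) (y.length + 1) = p')
    (hc : I.count₂ m n = (m', n')) (h : WalkPath y (walkConf q' p' m' n') D) :
    WalkPath y (walkConf q p m n) D := by
  have he : (walkConf q p m n).exec y I = walkConf q' p' m' n' := by
    rw [walkConf_exec, ht, hp, hc]
  refine .head hq ⟨false, I, hI false, he.symm⟩ ?_ h
  rintro C ⟨a, J, hJ, rfl⟩
  rw [← he]
  congr 1
  exact Option.some.inj (hJ.symm.trans (hI a))

theorem inputAt_append (u v : Word) (c : Bool) :
    inputAt (u ++ c :: v) (u.length + 1) = .bit c := by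
  rw [inputAt_succ (by simp)]
  simp

theorem WalkPath.bit {q q' : WalkState} {u v : Word} {c : Bool} {m n : ℕ}
    {D : CState 2 WalkState} (hy : y = u ++ c :: v)
    (hI : ∀ a, walkCmd q (.bit c) a = some { next := q', inMove := .right }) (hq : q ≠ .yes)
    (h : WalkPath y (walkConf q' (u.length + 2) m n) D) :
    WalkPath y (walkConf q (u.length + 1) m n) D := by
  refine .step { next := q', inMove := .right } ?_ hq rfl ?_ rfl h
  · rw [hy, inputAt_append]
    exact hI
  · simp [hy, Move.apply]

theorem WalkPath.block {q q' : WalkState} {m n : ℕ} {D : CState 2 WalkState}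
    (h1 : ∀ a, walkCmd q (.bit true) a = some { next := q, inMove := .right })
    (h0 : ∀ a, walkCmd q (.bit false) a = some { next := q', inMove := .right })
    (hq : q ≠ .yes) (s : ℕ) : ∀ u v : Word, y = u ++ (List.replicate s true ++ false :: v) →
    WalkPath y (walkConf q' (u.length + s + 2) m n) D →
    WalkPath y (walkConf q (u.length + 1) m n) D := by
  induction s with
  | zero => intro u v hy h; exact .bit (by simpa using hy) h0 hq h
  | succ s ih =>
    intro u v hy h
    refine .bit (u := u) (c := true) (v := List.replicate s true ++ false :: v)
      (by simpa [List.replicate_succ] using hy) h1 hq ?_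
    have := ih (u ++ [true]) v (by simpa [List.replicate_succ] using hy)
      (by convert h using 2; simp; omega)
    simpa using this

theorem WalkPath.load (b : Bool) (m : ℕ) (s : ℕ) : ∀ n (u v : Word),
    y = u ++ (List.replicate s true ++ false :: v) →
    WalkPath y (walkConf (.load b) (u.length + 1) m n)
      (walkConf (.row (some b)) (u.length + s + 2) m (n + s)) := by
  induction s with
  | zero => intro n u v hy; exact .bit (by simpa using hy) (fun _ => rfl) (by simp) (.refl _)
  | succ s ih =>
    intro n u v hy
    refine .step (q' := .load b) (p' := u.length + 2) (m' := m) (n' := n + 1)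
      { next := .load b, inMove := .right, op := some (1, true) } ?_ (by simp) rfl ?_ rfl ?_
    · rw [hy, List.replicate_succ, List.cons_append, inputAt_append]
      exact fun _ => rfl
    · simp [hy, Move.apply]; omega
    · convert ih (n + 1) (u ++ [true]) v (by simpa [List.replicate_succ] using hy) using 2
      · simp
      · simp; omega
      · omega

theorem WalkPath.count (f : Option Bool) (n : ℕ) (s : ℕ) : ∀ m (u v : Word),
    y = u ++ (List.replicate s true ++ false :: v) →
    WalkPath y (walkConf (.count f) (u.length + 1) m n)
      (walkConf (.rewind f) (u.length + s + 1) (m + s) n) := by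
  induction s with
  | zero =>
    intro m u v hy
    refine .step (q' := .rewind f) (p' := u.length + 1) { next := .rewind f }
      ?_ (by simp) rfl ?_ rfl (.refl _)
    · rw [hy, List.replicate_zero, List.nil_append, inputAt_append]
      exact fun _ => rfl
    · simp [hy, Move.apply]
  | succ s ih =>
    intro m u v hy
    refine .step (q' := .count f) (p' := u.length + 2) (m' := m + 1) (n' := n)
      { next := .count f, inMove := .right, op := some (0, true) } ?_ (by simp) rfl ?_ rfl ?_
    · rw [hy, List.replicate_succ, List.cons_append, inputAt_append]
      exact fun _ => rfl
    · simp [hy, Move.apply]; omega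
    · convert ih (m + 1) (u ++ [true]) v (by simpa [List.replicate_succ] using hy) using 2
      · simp
      · simp; omega
      · omega

theorem WalkPath.rewind (f : Option Bool) (m n : ℕ) (p : ℕ) (hp : p ≤ y.length + 1) :
    WalkPath y (walkConf (.rewind f) p m n) (walkConf (.rewind f) 0 m n) := by
  induction p with
  | zero => exact .refl _
  | succ p ih =>
    have hs : inputAt y (p + 1) ≠ .left := fun h => by simp [inputAt_eq_left] at h
    refine .step (p' := p) { next := .rewind f, inMove := .left } ?_ (by simp) rfl ?_ rfl
      (ih (by omega))
    · generalize inputAt y (p + 1) = s at hs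
      cases s <;> first | exact fun _ => rfl | contradiction
    · simp [Move.apply]; omega

/-- Each successful decrement of counter `0` pays for skipping one row; the failing decrement at
zero signals that the wanted row starts here. -/
theorem WalkPath.seek (f : Option Bool) (n : ℕ) (l : List (Bool × ℕ × ℕ)) : ∀ u v : Word,
    y = u ++ (l.flatMap encodeRow ++ v) →
    WalkPath y (walkConf (.seek f) (u.length + 1) l.length n)
      (walkConf (.row f) (u.length + (l.flatMap encodeRow).length + 1) 0 n) := by
  induction l with
  | nil =>
    intro u v hy
    refine .step { next := .row₀ f, fail := .row f, op := some (0, false) } (fun _ => rfl)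
      (by simp) rfl ?_ rfl (.refl _)
    simp [hy, Move.apply]
  | cons r l ih =>
    intro u v hy
    obtain ⟨c, s, t⟩ := r
    simp only [List.flatMap_cons, encodeRow, List.cons_append, List.append_assoc,
      List.nil_append] at hy
    refine .step (q' := .row₀ f) (p' := u.length + 1) (m' := l.length) (n' := n)
      { next := .row₀ f, fail := .row f, op := some (0, false) } (fun _ => rfl)
      (by simp) rfl ?_ rfl ?_
    · simp [hy, Move.apply]
    refine .bit hy (q' := .row₁ f) (fun _ => rfl) (by simp) ?_
    have h1 := WalkPath.block (y := y) (q := .row₁ f) (q' := .row₂ f) (m := l.length) (n := n)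
      (D := walkConf (.row f) (u.length + (((c, s, t) :: l).flatMap encodeRow).length + 1) 0 n)
      (fun _ => rfl) (fun _ => rfl) (by simp) s (u ++ [c]) _ (by simpa using hy)
    refine cast (by simp) (h1 ?_)
    have h2 := WalkPath.block (y := y) (q := .row₂ f) (q' := .seek f) (m := l.length) (n := n)
      (D := walkConf (.row f) (u.length + (((c, s, t) :: l).flatMap encodeRow).length + 1) 0 n)
      (fun _ => rfl) (fun _ => rfl) (by simp) t (u ++ [c] ++ List.replicate s true ++ [false]) _
      (by simpa using hy)
    rw [show (u ++ [c]).length + s + 2 =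
      (u ++ [c] ++ List.replicate s true ++ [false]).length + 1 by simp; omega]
    refine h2 ?_
    convert ih (u ++ encodeRow (c, s, t)) v (by simpa [encodeRow] using hy) using 2
    · simp [encodeRow]; omega
    · simp [encodeRow]; omega

/-- The part of the input that precedes the transition table. -/
def queryHeader (b : Bool) (i : ℕ) : Word := b :: (List.replicate (i + 1) true ++ [false])

theorem bitQuery_eq (b : Bool) (i : ℕ) (x : Word) : bitQuery b i x = queryHeader b i ++ x := by
  simp [bitQuery, queryHeader]

/-- The position of row `r`. -/
def rowPos (b : Bool) (i : ℕ) (l : List (Bool × ℕ × ℕ)) (r : ℕ) : ℕ :=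
  (queryHeader b i).length + ((l.take r).flatMap encodeRow).length + 1

theorem WalkPath.find (f : Option Bool) (b : Bool) (i n : ℕ) (l : List (Bool × ℕ × ℕ)) (r p : ℕ)
    (hr : r ≤ l.length) (hp : p ≤ (bitQuery b i (l.flatMap encodeRow)).length + 1) :
    WalkPath (bitQuery b i (l.flatMap encodeRow)) (walkConf (.rewind f) p r n)
      (walkConf (.row f) (rowPos b i l r) 0 n) := by
  refine (WalkPath.rewind f r n p hp).trans ?_
  refine WalkPath.step (q' := .header f) (p' := 1) { next := .header f, inMove := .right }
    (fun _ => rfl) (by simp) rfl (by simp [Move.apply]) rfl ?_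
  refine WalkPath.bit (u := []) rfl (q' := .header' f) (fun _ => rfl) (by simp) ?_
  refine WalkPath.block (q := .header' f) (q' := .seek f) (fun _ => rfl) (fun _ => rfl) (by simp)
    (i + 1) [b] (l.flatMap encodeRow) rfl ?_
  have h := WalkPath.seek (y := bitQuery b i (l.flatMap encodeRow)) f n (l.take r)
    (queryHeader b i) ((l.drop r).flatMap encodeRow) (by
      rw [bitQuery_eq, ← List.flatMap_append, List.take_append_drop])
  rw [List.length_take, min_eq_left hr] at h
  convert h using 2
  · simp [queryHeader]
    omega
  · rfl

/-- The block of the successor on `c` is read into counter `0`, the first block being skipped if `c`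
is `1`. The current row may then be forgotten, since the target is located by its number from the
start of the table. -/
theorem WalkPath.fetch (f : Option Bool) (b c : Bool) (i n : ℕ) (l : List (Bool × ℕ × ℕ)) (q : ℕ)
    (hq : q < l.length) (hr : (if c then l[q].2.2 else l[q].2.1) ≤ l.length) :
    WalkPath (bitQuery b i (l.flatMap encodeRow)) (walkConf (.fetch c f) (rowPos b i l q) 0 n)
      (walkConf (.row f) (rowPos b i l (if c then l[q].2.2 else l[q].2.1)) 0 n) := by
  obtain ⟨⟨d, s, t⟩, hl⟩ : ∃ r, r = l[q] := ⟨_, rfl⟩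
  rw [← hl] at hr ⊢
  have hy : bitQuery b i (l.flatMap encodeRow) =
      (queryHeader b i ++ (l.take q).flatMap encodeRow) ++ d :: (List.replicate s true ++ false ::
        (List.replicate t true ++ false :: (l.drop (q + 1)).flatMap encodeRow)) := by
    conv_lhs => rw [← List.take_append_drop q l, List.drop_eq_getElem_cons hq, ← hl]
    rw [bitQuery_eq]
    simp [encodeRow]
  have hp : rowPos b i l q = (queryHeader b i ++ (l.take q).flatMap encodeRow).length + 1 := by
    simp [rowPos]
  rw [hp]
  generalize queryHeader b i ++ (l.take q).flatMap encodeRow = u at hy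
  cases c
  · refine .bit hy (q' := .count f) (fun _ => rfl) (by simp) ?_
    have h := WalkPath.count f n s 0 (u ++ [d]) _ (by simpa using hy)
    refine (cast (by simp) h : WalkPath _ _ (walkConf (.rewind f) (u.length + 1 + s + 1) s n)).trans
      (WalkPath.find f b i n l s _ hr ?_)
    simp [hy]; omega
  · refine .bit hy (q' := .pass f) (fun _ => rfl) (by simp) ?_
    have h := WalkPath.block (m := 0) (n := n) (q := .pass f) (q' := .count f)
      (D := walkConf (.row f) (rowPos b i l t) 0 n) (fun _ => rfl) (fun _ => rfl) (by simp) s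
      (u ++ [d]) _ (by simpa using hy)
    refine cast (by simp) (h ?_)
    have h := WalkPath.count f n t 0 (u ++ [d] ++ List.replicate s true ++ [false]) _
      (by simpa using hy)
    rw [show (u ++ [d]).length + s + 2 =
      (u ++ [d] ++ List.replicate s true ++ [false]).length + 1 by simp; omega]
    rw [Nat.zero_add] at h
    refine h.trans (WalkPath.find f b i n l t _ hr ?_)
    simp [hy]; omega

end walk

/-! ### Simulation of the automaton letter by letter. -/

section table

variable (T : Table) (b : Bool) (i : ℕ)

/-- The configuration in which the letters of `u` have been guessed. -/
def guessConf (u : Word) : CState 2 WalkState :=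
  walkConf (.row (if u.length ≤ i then some b else none))
    (rowPos b i (List.ofFn T.row) (T.toDFA.eval u).val) 0 (i - u.length)

/-- Once the next letter `c` is fixed, the machine finds the row of the next state. -/
theorem guess_fetch (f : Option Bool) (c : Bool) (n : ℕ) (u : Word) :
    WalkPath (bitQuery b i T.encode)
      (walkConf (.fetch c f) (rowPos b i (List.ofFn T.row) (T.toDFA.eval u).val) 0 n)
      (walkConf (.row f) (rowPos b i (List.ofFn T.row) (T.toDFA.eval (u ++ [c])).val) 0 n) := by
  have hq : (T.toDFA.eval u).val < (List.ofFn T.row).length := by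
    rw [List.length_ofFn]; exact (T.toDFA.eval u).isLt
  have hr : (if c then (List.ofFn T.row)[(T.toDFA.eval u).val].2.2
      else (List.ofFn T.row)[(T.toDFA.eval u).val].2.1) = (T.toDFA.eval (u ++ [c])).val := by
    rw [DFA.eval_append_singleton, List.getElem_ofFn]
    cases c <;> rfl
  have h := WalkPath.fetch f b c i n (List.ofFn T.row) _ hq (by
    rw [hr, List.length_ofFn]; exact (T.toDFA.eval (u ++ [c])).isLt.le)
  rw [hr] at h
  exact h

/-- A row begins with its acceptance bit, so in state `row` the head already sees whether the
current state accepts. -/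
theorem inputAt_rowPos (q : Fin (T.n + 1)) :
    inputAt (bitQuery b i T.encode) (rowPos b i (List.ofFn T.row) q) = .bit (T.acc q) := by
  have hq : q.val < (List.ofFn T.row).length := by
    rw [List.length_ofFn]; exact q.isLt
  have h : bitQuery b i T.encode =
      (queryHeader b i ++ ((List.ofFn T.row).take q).flatMap encodeRow) ++ T.acc q ::
        (List.replicate (T.next q false : ℕ) true ++ false ::
          (List.replicate (T.next q true : ℕ) true ++
            false :: ((List.ofFn T.row).drop (q + 1)).flatMap encodeRow)) := by
    rw [bitQuery_eq, Table.encode]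
    conv_lhs => rw [← List.take_append_drop q.val (List.ofFn T.row),
      List.drop_eq_getElem_cons hq, List.getElem_ofFn]
    simp [encodeRow, Table.row]
  rw [h, rowPos, ← List.length_append, inputAt_append]

theorem rowPos_le (q : Fin (T.n + 1)) :
    rowPos b i (List.ofFn T.row) q ≤ (bitQuery b i T.encode).length + 1 :=
  (inputAt_bit (inputAt_rowPos T b i q)).2.trans (Nat.le_succ _)

theorem stay_rowPos (q : Fin (T.n + 1)) :
    min (Move.stay.apply (rowPos b i (List.ofFn T.row) q)) ((bitQuery b i T.encode).length + 1) =
      rowPos b i (List.ofFn T.row) q :=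
  min_eq_left (rowPos_le T b i q)

theorem guess_init : WalkPath (bitQuery b i T.encode) walkMachine.init (guessConf T b i []) := by
  have h0 : walkMachine.init = walkConf .init 0 0 0 := by
    simp only [CounterMachine.init, walkConf, CState.mk.injEq, true_and]
    funext i
    fin_cases i <;> rfl
  rw [h0]
  refine WalkPath.step (q' := .init) (p' := 1) { next := .init, inMove := .right }
    (fun _ => rfl) (by simp) rfl (by simp [Move.apply]) rfl ?_
  refine WalkPath.bit (u := []) rfl (q' := .skip b) (fun _ => rfl) (by simp) ?_
  -- A query contains `i + 1` ones, because its author stands at cell `i + 1`; state `skip` drops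
  -- one of them, so that counter `1` starts at `i`.
  refine WalkPath.bit (u := [b]) (v := List.replicate i true ++ false :: T.encode) rfl
    (q' := .load b) (fun _ => rfl) (by simp) ?_
  have h := WalkPath.load (y := bitQuery b i T.encode) b 0 i 0 [b, true] T.encode rfl
  refine cast ?_ h
  congr 1
  simp only [guessConf, List.length_nil, Nat.zero_le, if_true, DFA.eval_nil]
  congr 1
  · simp [rowPos, queryHeader, Table.toDFA]; omega
  · omega

/-- The step with guess `a` out of a configuration in which `u` has been guessed either accepts or
guesses another letter. -/
theorem guess_step (u : Word) (a : Bool) :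
    ∃ I, walkCmd (guessConf T b i u).state
        (inputAt (bitQuery b i T.encode) (guessConf T b i u).inPos) a = some I ∧
      ((i < u.length ∧ u ∈ T.toDFA.accepts ∧
          ((guessConf T b i u).exec (bitQuery b i T.encode) I).state = .yes) ∨
        ¬ (i < u.length ∧ u ∈ T.toDFA.accepts) ∧
          WalkPath (bitQuery b i T.encode) ((guessConf T b i u).exec (bitQuery b i T.encode) I)
            (guessConf T b i (u ++ [if u.length = i then b else a]))) := by
  rw [show (guessConf T b i u).inPos = rowPos b i (List.ofFn T.row) (T.toDFA.eval u).val from rfl,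
    inputAt_rowPos]
  -- Before bit `i` the guess is free. At bit `i` counter `1` is zero, the decrement fails, and the
  -- letter `b` is used whatever the guess. Beyond it the machine accepts in an accepting state and
  -- otherwise guesses freely.
  rcases lt_trichotomy u.length i with hu | hu | hu
  · refine ⟨{ next := .fetch a (some b), fail := .fetch b none, op := some (1, false) }, ?_,
      .inr ⟨fun h => absurd h.1 hu.not_gt, ?_⟩⟩
    · simp only [guessConf, if_pos hu.le]
      rfl
    have h := guess_fetch T b i (some b) a (i - u.length - 1) u
    rw [guessConf, walkConf_exec]
    simp only [Cmd.target, Cmd.count₂, stay_rowPos, if_neg hu.ne]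
    have hn : i - u.length ≠ 0 := by omega
    have hl : (u ++ [a]).length ≤ i := by simp; omega
    simp only [guessConf, if_pos hl]
    simpa [hn, Nat.sub_sub] using h
  · refine ⟨{ next := .fetch a (some b), fail := .fetch b none, op := some (1, false) }, ?_,
      .inr ⟨fun h => absurd h.1 hu.not_gt, ?_⟩⟩
    · simp only [guessConf, if_pos hu.le]
      rfl
    have h := guess_fetch T b i none b 0 u
    rw [guessConf, walkConf_exec]
    simp only [Cmd.target, Cmd.count₂, stay_rowPos, if_pos hu]
    have hl : ¬ (u ++ [b]).length ≤ i := by simp; omega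
    simp only [guessConf, if_neg hl]
    simpa [hu] using h
  · have hs : (guessConf T b i u).state = .row none := by
      simp only [guessConf, if_neg hu.not_ge]
      rfl
    cases hacc : T.acc (T.toDFA.eval u)
    · refine ⟨{ next := .fetch a none }, by rw [hs]; rfl, .inr ⟨fun h => ?_, ?_⟩⟩
      · exact Bool.false_ne_true (hacc.symm.trans h.2)
      have h := guess_fetch T b i none a 0 u
      rw [guessConf, walkConf_exec]
      simp only [Cmd.target, Cmd.count₂, stay_rowPos, if_neg hu.ne']
      have hl : ¬ (u ++ [a]).length ≤ i := by simp; omega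
      simp only [guessConf, if_neg hl]
      have h1 : i - u.length = 0 := by omega
      have h2 : i - (u.length + 1) = 0 := by omega
      simpa [h1, h2] using h
    · exact ⟨{ next := .yes }, by rw [hs]; rfl, .inl ⟨hu, hacc, rfl⟩⟩

/-- One more letter is guessed, or the word guessed so far is accepted. -/
def GuessRel (s t : Word × Bool) : Prop :=
  s.2 = false ∧ ((t.2 = false ∧ ∃ c, (s.1.length = i → c = b) ∧ t.1 = s.1 ++ [c]) ∨
    (t = (s.1, true) ∧ i < s.1.length ∧ s.1 ∈ T.toDFA.accepts))

theorem GuessRel.spec {s : Word × Bool}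
    (h : Relation.ReflTransGen (GuessRel T b i) ([], false) s) :
    (i < s.1.length → s.1[i]? = some b) ∧
      (s.2 = true → i < s.1.length ∧ s.1 ∈ T.toDFA.accepts) := by
  induction h with
  | refl => simp
  | @tail s t _ hst ih =>
    obtain ⟨s, e⟩ := s
    obtain ⟨t, e'⟩ := t
    obtain ⟨-, ⟨h1, c, hc, h2⟩ | ⟨h1, h2⟩⟩ := hst
    · simp only at h1 h2 hc ih
      subst h1 h2
      refine ⟨fun hi => ?_, by simp⟩
      rcases lt_or_ge i s.length with h | h
      · rw [List.getElem?_append_left h]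
        exact ih.1 h
      · have : s.length = i := by simp at hi; omega
        subst this
        simp [hc rfl]
    · cases h1
      exact ⟨ih.1, fun _ => h2⟩

/-- For soundness, runs are abstracted to the word guessed so far together with a flag for
acceptance, and the invariant `GuessRel.spec` is read off at the end. For completeness, the letters
of `v` are supplied as guesses. -/
theorem walk_spec : (∃ C, walkMachine.Reachable (bitQuery b i T.encode) C ∧ C.state = .yes) ↔
    ∃ v ∈ T.toDFA.accepts, v[i]? = some b := by
  constructor
  · rintro ⟨C, hC, hy⟩
    obtain ⟨s, C', hs, hrep, hf⟩ := Forced.exists_of_reachable (b₀ := (([], false) : Word × Bool))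
      (S := GuessRel T b i) (B := fun C => C.state ≠ .yes)
      (Rep := fun s C => if s.2 then C.state = .yes else C = guessConf T b i s.1)
      ⟨_, rfl, guess_init T b i⟩ (by
        rintro ⟨u, e⟩ C C' - hrep ⟨a, I, hI, rfl⟩
        cases e
        · simp only [Bool.false_eq_true, if_false] at hrep
          subst hrep
          obtain ⟨J, hJ, h⟩ := guess_step T b i u a
          cases Option.some.inj (hI.symm.trans hJ)
          rcases h with ⟨h1, h2, h3⟩ | ⟨-, h⟩
          · exact ⟨(u, true), _, ⟨rfl, .inr ⟨rfl, h1, h2⟩⟩, h3, .refl _⟩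
          · exact ⟨(_, false), _, ⟨rfl, .inl ⟨rfl, _, fun h => if_pos h, rfl⟩⟩, rfl, h⟩
        · simp only [if_true] at hrep
          rw [hrep] at hI
          simp [walkCmd] at hI) hC
    obtain rfl := hf.eq_of_not (not_not.2 hy)
    obtain ⟨u, e⟩ := s
    cases e
    · simp only [Bool.false_eq_true, if_false] at hrep
      subst hrep
      simp [guessConf, walkConf] at hy
    · obtain ⟨h1, h2⟩ := GuessRel.spec T b i hs
      exact ⟨u, (h2 rfl).2, h1 (h2 rfl).1⟩
  · rintro ⟨v, hv, hb⟩
    have key : ∀ v' u, u ++ v' = v →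
        walkMachine.Reachable (bitQuery b i T.encode) (guessConf T b i u) →
        ∃ C, walkMachine.Reachable (bitQuery b i T.encode) C ∧ C.state = .yes := by
      intro v'
      induction v' with
      | nil =>
        intro u hu hr
        rw [List.append_nil] at hu
        subst hu
        obtain ⟨I, hI, ⟨-, -, h⟩ | ⟨h, -⟩⟩ := guess_step T b i u false
        · exact ⟨_, hr.tail ⟨_, I, hI, rfl⟩, h⟩
        · exact absurd ⟨(List.getElem?_eq_some_iff.1 hb).1, hv⟩ h
      | cons c v' ih =>
        intro u hu hr
        obtain ⟨I, hI, ⟨-, -, h⟩ | ⟨-, h⟩⟩ := guess_step T b i u c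
        -- The machine may accept early, at a proper prefix of `v`; this is harmless, since only
        -- acceptance is claimed.
        · exact ⟨_, hr.tail ⟨_, I, hI, rfl⟩, h⟩
        · have hc : (if u.length = i then b else c) = c := by
            split_ifs with hi
            · rw [← hu, ← hi] at hb
              simpa using hb.symm
            · rfl
          rw [hc] at h
          exact ih (u ++ [c]) (by simpa using hu)
            ((hr.tail ⟨_, I, hI, rfl⟩).trans h.reflTransGen)
    exact key v [] rfl (guess_init T b i).reflTransGen

end table

/-- The oracle that answers questions about the bits of accepted words. -/
def bitOracle : Set Word := {y | (walkMachine.toNTM .yes).Accepts y}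

theorem NL_bitOracle : NL bitOracle :=
  ⟨walkMachine.toNTM .yes, (walkMachine.toNTM_spec .yes walkMachine_bound).1, fun _ => Iff.rfl⟩

theorem bitQuery_mem (T : Table) (b : Bool) (i : ℕ) :
    bitQuery b i T.encode ∈ bitOracle ↔ ∃ v ∈ T.toDFA.accepts, v[i]? = some b :=
  ((walkMachine.toNTM_spec .yes walkMachine_bound).2 _).trans (walk_spec T b i)

/-! ## Automata of one-element languages -/

theorem lang_encode (T : Table) : lang T.encode = {v | v ∈ T.toDFA.accepts} := by
  rw [lang, automaton_encode]

/-- The state counts matched letters. After a mismatch, or a letter beyond the end of `w`, it is the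
sink, whose index lies outside `w`, so that no letter leads out of it. -/
theorem chainTable_eval (w u : Word) :
    ((chainTable w).toDFA.eval u).val = if u <+: w then u.length else w.length + 1 := by
  induction u using List.reverseRecOn with
  | nil => simp [chainTable, Table.toDFA]
  | append_singleton u c ih =>
    rw [DFA.eval_append_singleton]
    change (if w[((chainTable w).toDFA.eval u).val]? = some c
      then ((chainTable w).toDFA.eval u).val + 1 else w.length + 1) = _
    rw [ih]
    by_cases hu : u <+: w
    · obtain ⟨v, rfl⟩ := hu
      rcases v with _ | ⟨d, v⟩ <;> simp [List.prefix_append_right_inj, eq_comm]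
    · have h : ¬ u ++ [c] <+: w := fun h => hu ((List.prefix_append _ _).trans h)
      simp [hu, h]

theorem lang_chainTable (w : Word) : lang (chainTable w).encode = {w} := by
  rw [lang_encode]
  ext u
  have h : u ∈ (chainTable w).toDFA.accepts ↔
      ((chainTable w).toDFA.eval u).val = w.length := by
    change decide _ = true ↔ _
    rw [decide_eq_true_iff]
    rfl
  rw [Set.mem_ofPred_eq, h, chainTable_eval, Set.mem_singleton_iff]
  split_ifs with hu
  · exact ⟨hu.eq_of_length, fun h => by rw [h]⟩
  · exact ⟨fun h => by omega, fun h => absurd (h ▸ List.prefix_rfl) hu⟩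

/-- The prefixes of `w ++ [true]` reach pairwise different states: for `i < j` the continuation
`w.drop i` completes the shorter prefix to `w`, but makes the longer one a word of length greater
than `w.length`. The extra letter accounts for the dead state of a complete DFA. -/
theorem length_le_numStates {y w : Word} (h : lang y = {w}) : w.length + 2 ≤ numStates y := by
  have hacc : ∀ u, (automaton y).toDFA.eval u ∈ (automaton y).toDFA.accept ↔ u = w := fun u =>
    (Set.ext_iff.1 h u)
  have hinj : Function.Injective fun i : Fin (w.length + 2) =>
      (automaton y).toDFA.eval ((w ++ [true]).take i) := by
    have key : ∀ i j : Fin (w.length + 2), i < j →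
        (automaton y).toDFA.eval ((w ++ [true]).take i) ≠
          (automaton y).toDFA.eval ((w ++ [true]).take j) := by
      intro i j hij he
      have hi : i.val ≤ w.length := by have := j.isLt; have : i.val < j.val := hij; omega
      have h1 : (automaton y).toDFA.eval ((w ++ [true]).take i ++ w.drop i) ∈
          (automaton y).toDFA.accept := by
        rw [hacc, List.take_append_of_le_length hi, List.take_append_drop]
      have h2 : (automaton y).toDFA.eval ((w ++ [true]).take i ++ w.drop i) =
          (automaton y).toDFA.eval ((w ++ [true]).take j ++ w.drop i) := by
        simp only [DFA.eval, DFA.evalFrom_of_append] at he ⊢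
        rw [he]
      rw [h2, hacc] at h1
      have := congrArg List.length h1
      have hj := j.isLt
      have hij' : i.val < j.val := hij
      simp at this
      omega
    intro i j he
    rcases lt_trichotomy i j with hij | hij | hij
    · exact absurd he (key i j hij)
    · exact hij
    · exact absurd he.symm (key j i hij)
  simpa [numStates] using Fintype.card_le_of_injective _ hinj

theorem isMinimalDFA_chainTable (w : Word) : IsMinimalDFA (chainTable w).encode {w} := by
  refine ⟨lang_chainTable w, fun y hy => ?_⟩
  rw [numStates, automaton_encode]
  exact length_le_numStates hy

/-- A word that encodes no table stands for the empty language, so the promise excludes it. -/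
theorem exists_encode {x w : Word} (h : lang x = {w}) : ∃ T : Table, T.encode = x := by
  by_contra hx
  have hw : w ∈ lang x := h ▸ rfl
  rw [lang, automaton, dif_neg hx] at hw
  exact Bool.false_ne_true hw

theorem numStates_encode_le (T : Table) : numStates T.encode ≤ T.encode.length := by
  have h : ∀ l : List (Bool × ℕ × ℕ), l.length ≤ (l.flatMap encodeRow).length := by
    intro l
    induction l with
    | nil => simp
    | cons r l ih => simp [encodeRow] at ih ⊢; omega
  rw [numStates, automaton_encode]
  simpa [Table.encode] using h (List.ofFn T.row)

/-- When only `w` is accepted, the existential question about accepted words becomes a question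
about `w` itself. The counting of states guarantees that `w` is short enough to be extracted. -/
theorem extract_bitOracle {x w : Word} (h : lang x = {w}) : extract bitOracle x = w := by
  obtain ⟨T, rfl⟩ := exists_encode h
  refine extract_eq ?_ fun b i => ?_
  · have := length_le_numStates h
    have := numStates_encode_le T
    omega
  · rw [lang_encode] at h
    have hv : ∀ v, v ∈ T.toDFA.accepts ↔ v = w := fun v => Set.ext_iff.1 h v
    simp [bitQuery_mem, hv]

/-! ## Reductions -/

theorem NL_empty : NL ∅ :=
  ⟨⟨0, Unit, Unit, inferInstance, inferInstance, (), (), ∅, fun _ _ _ => ∅⟩,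
    ⟨0, fun _ _ _ j => j.elim0⟩, fun _ => ⟨fun ⟨_, _, h⟩ => h, fun h => h.elim⟩⟩

theorem FL.fnl {f : Word → Word} (h : FL f) : FNL f := by
  obtain ⟨M, -, h⟩ := h
  exact ⟨M, ∅, NL_empty, h⟩

theorem mem_reg_iff {x w : Word} {L : Set Word} (h : lang x = {w}) : x ∈ reg L ↔ w ∈ L := by
  simp [reg, h]

/-- The set `S` is left free to cover both promises, with words from `P.yes ∪ P.no` and with all
words. -/
theorem reducesVia_chain (P : PromiseProblem) {S : Set Word} (hS : P.yes ∪ P.no ⊆ S) :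
    ReducesVia (fun w => (chainTable w).encode) P (rrPromise P.yes (singletons S)) := by
  refine ⟨fun w hw => ⟨⟨w, hS (.inl hw), lang_chainTable w⟩, ?_⟩,
    fun w hw => ⟨⟨w, hS (.inr hw), lang_chainTable w⟩, ?_⟩⟩
  · rwa [mem_reg_iff (lang_chainTable w)]
  · rw [mem_reg_iff (lang_chainTable w)]
    exact fun h => Set.disjoint_left.1 P.disj h hw

theorem reducesVia_extract (P : PromiseProblem) :
    ReducesVia (extract bitOracle) (rrPromise P.yes (singletons (P.yes ∪ P.no))) P := by
  refine ⟨?_, ?_⟩ <;> rintro x ⟨⟨w, hw, hx⟩, hr⟩ <;> rw [mem_reg_iff hx] at hr <;>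
    rw [extract_bitOracle hx]
  · exact hr
  · exact hw.resolve_left hr

end RegReal

theorem mainTheorem5 :
    ∃ A g : Word → Word,
      FL A ∧ FNL g ∧
      (∀ w, IsMinimalDFA (A w) {w}) ∧
      (∀ x w, lang x = {w} → g x = w) ∧
      ∀ P : PromiseProblem, P.yes.Nonempty →
        -- equivalence with an RR promise problem about one-element languages
        NLEquiv P (rrPromise P.yes (singletons (P.yes ∪ P.no))) ∧
        ReducesVia A P (rrPromise P.yes (singletons (P.yes ∪ P.no))) ∧
        ReducesVia g (rrPromise P.yes (singletons (P.yes ∪ P.no))) P ∧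
        -- all one-element languages as instances
        ReducesVia A P (rrPromise P.yes (singletons Set.univ)) ∧
        (∀ x, lang x ∈ singletons Set.univ → (x ∈ reg P.yes ↔ g x ∈ P.yes)) ∧
        (P.yes ∪ P.no = Set.univ → NLEquiv P (rrPromise P.yes (singletons Set.univ))) := by
  have hA := FL_chainTable
  have hg := FNL_extract NL_bitOracle
  have hequiv : ∀ P : PromiseProblem,
      NLEquiv P (rrPromise P.yes (singletons (P.yes ∪ P.no))) := fun P =>
    ⟨⟨_, hA.fnl, reducesVia_chain P subset_rfl⟩, ⟨_, hg, reducesVia_extract P⟩⟩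
  -- If every word is a yes- or a no-instance, the two promises coincide, so the last equivalence is
  -- the first one rewritten.
  refine ⟨_, _, hA, hg, isMinimalDFA_chainTable, fun x w => extract_bitOracle, fun P _ =>
    ⟨hequiv P, reducesVia_chain P subset_rfl, reducesVia_extract P,
      reducesVia_chain P (Set.subset_univ _), ?_, fun h => h ▸ hequiv P⟩⟩
  rintro x ⟨w, -, hx⟩
  rw [mem_reg_iff hx, extract_bitOracle hx]
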